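/- Let $\mathbb{H}$ be the quaternions, $\mathbb{S}=\{I\in\mathbb{H}: I^2=-1\}$ with its standard area measure $d\sigma$, and $\mathbb{C}_I=\mathbb{R}+\mathbb{R}I$. Write $q\in\mathbb{H}\setminus\mathbb{R}$ as $q=x+I_q y$ with $x\in\mathbb{R}$, $y>0$, $I_q\in\mathbb{S}$, and let $$\Box_q=-\tfrac14\Big(\tfrac{\partial^2}{\partial x^2}+\tfrac{\partial^2}{\partial y^2}\Big)+\tfrac12\Big(x\tfrac{\partial}{\partial x}+y\tfrac{\partial}{\partial y}\Big)+\tfrac{I_q}{2}\Big(x\tfrac{\partial}{\partial y}-y\tfrac{\partial}{\partial x}\Big),$$ acting on $\mathbb{H}$-valued functions that are real differentiable on $\mathbb{H}\setminus\mathbb{R}$ and of class $C^2$ in $(x,y)$ on each slice $\mathbb{C}_I\setminus\mathbb{R}$. A function $f$ on $\mathbb{H}\setminus\mathbb{R}$ is slice regular if it is real differentiable there and, for every $I\in\mathbb{S}$, its restriction $f_I$ to $\mathbb{C}_I\setminus\mathbb{R}$ is of class $C^1$ with $\frac12(\partial_x+I\partial_y)f_I=0$. For a measure $\nu$ on $\mathbb{H}$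 put $$\mathcal{F}_0^2(\nu)=\{f\in L^2(\mathbb{H}\setminus\mathbb{R};e^{-|q|^2}d\nu):\ \Box_q f=0\},\qquad \mathcal{F}^2_{full}(\nu)=\mathcal{SR}(\mathbb{H}\setminus\mathbb{R})\cap L^2(\mathbb{H}\setminus\mathbb{R};e^{-|q|^2}d\nu).$$ Let $\lambda$ be Lebesgue measure $dx_0dx_1dx_2dx_3$, and let $\lambda_{pol}$ be the sliced polar measure, i.e. the image of $r\,dr\,d\theta\,d\sigma(I)$ on $(0,\infty)\times(0,2\pi)\times\mathbb{S}$ under $(r,\theta,I)\mapsto re^{I\theta}$. Then: 1. $\mathcal{F}_0^2(\lambda)=\mathcal{F}^2_{full}(\lambda)$ and $\mathcal{F}_0^2(\lambda_{pol})=\mathcal{F}^2_{full}(\lambda_{pol})$. 2. Let $K$ be the set of functions $f$ on $\mathbb{H}\setminus\mathbb{R}$ such that, for every $I\in\mathbb{S}$, the restriction $f_I$ to $\mathbb{C}_I\setminus\mathbb{R}$ has a limit at every point of $\mathbb{R}$ (possibly depending on $I$). Then $\mathcal{F}_0^2(\lambda_{pol})\cap K=\mathcal{F}^2_{full}(\lambda_{pol})\cap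 K$, and this space is the set of all functions $f$, real differentiable on $\mathbb{H}\setminus\mathbb{R}$, for which there are measurable functions $I\mapsto C_n^I\in\mathbb{H}$ ($n\ge 0$) on $\mathbb{S}$ with $$f(q)=\sum_{n=0}^\infty q^n C_n^I\quad\text{for all } I\in\mathbb{S},\ q\in\mathbb{C}_I\setminus\mathbb{R},\qquad \sum_{n=0}^\infty n!\int_{\mathbb{S}}|C_n^I|^2\,d\sigma(I)<\infty .$$ -/

import Mathlib

open MeasureTheory Filter Topology
open scoped Quaternion ENNReal

namespace SliceFock

noncomputable section

/-- The Borel sigma-algebra on the quaternions. -/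
instance instMeasurableSpaceQuaternion : MeasurableSpace ℍ := borel ℍ

instance instBorelSpaceQuaternion : BorelSpace ℍ := ⟨rfl⟩

/-- The sphere `𝕊` of imaginary units. -/
def imUnits : Set ℍ := {I | I * I = -1}

/-- `ℍ ∖ ℝ`. -/
def offReal : Set ℍ := {q | q.im ≠ 0}

/-- The point `x + I y` of the slice `ℂ_I`. -/
def slicePt (I : ℍ) (x y : ℝ) : ℍ := (x : ℍ) + y • I

/-- The imaginary unit `I_q` of `q ∈ ℍ ∖ ℝ`, so that `q = x + I_q y` with `y = |Im q| > 0`. -/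
def unitOf (q : ℍ) : ℍ := ‖q.im‖⁻¹ • q.im

/-- `∂f_I/∂x` at `x + I y`. -/
def partialX (f : ℍ → ℍ) (I : ℍ) (x y : ℝ) : ℍ := deriv (fun s : ℝ => f (slicePt I s y)) x

/-- `∂f_I/∂y` at `x + I y`. -/
def partialY (f : ℍ → ℍ) (I : ℍ) (x y : ℝ) : ℍ := deriv (fun t : ℝ => f (slicePt I x t)) y

/-- `∂²f_I/∂x²` at `x + I y`. -/
def partialXX (f : ℍ → ℍ) (I : ℍ) (x y : ℝ) : ℍ :=
  iteratedDeriv 2 (fun s : ℝ => f (slicePt I s y)) x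

/-- `∂²f_I/∂y²` at `x + I y`. -/
def partialYY (f : ℍ → ℍ) (I : ℍ) (x y : ℝ) : ℍ :=
  iteratedDeriv 2 (fun t : ℝ => f (slicePt I x t)) y

/-- The restriction of `f` to every slice `Ω ∩ ℂ_I` is of class `C^k` in the coordinates `(x, y)`. -/
def SliceContDiff (k : ℕ) (f : ℍ → ℍ) (Ω : Set ℍ) : Prop :=
  ∀ I ∈ imUnits,
    ContDiffOn ℝ k (fun p : ℝ × ℝ => f (slicePt I p.1 p.2)) {p | slicePt I p.1 p.2 ∈ Ω}

/-- Slice (left) regular functions on `Ω`: real differentiable on `Ω`, with all restrictions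
`f_I` having continuous partial derivatives and satisfying `½ (∂/∂x + I ∂/∂y) f_I = 0`. -/
def sliceRegular (Ω : Set ℍ) : Set (ℍ → ℍ) :=
  {f | DifferentiableOn ℝ f Ω ∧ SliceContDiff 1 f Ω ∧
    ∀ I ∈ imUnits, ∀ x y : ℝ, slicePt I x y ∈ Ω →
      (1 / 2 : ℝ) • (partialX f I x y + I * partialY f I x y) = 0}

/-- The operator `-¼ (∂²/∂x² + ∂²/∂y²) + ½ (x ∂/∂x + y ∂/∂y) + (I/2) (x ∂/∂y - y ∂/∂x)`
on the slice `ℂ_I`, evaluated at `x + I y`. -/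
def boxAt (f : ℍ → ℍ) (I : ℍ) (x y : ℝ) : ℍ :=
  -((1 / 4 : ℝ) • (partialXX f I x y + partialYY f I x y))
    + (1 / 2 : ℝ) • (x • partialX f I x y + y • partialY f I x y)
    + (1 / 2 : ℝ) • (I * (x • partialY f I x y - y • partialX f I x y))

/-- The sliced operator `□_q` on `ℍ ∖ ℝ`. -/
def box (f : ℍ → ℍ) (q : ℍ) : ℍ := boxAt f (unitOf q) q.re ‖q.im‖

/-- The quaternion `x₀ + x₁ i + x₂ j + x₃ k`. -/
def ofCoords (x₀ x₁ x₂ x₃ : ℝ) : ℍ := ⟨x₀, x₁, x₂, x₃⟩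

/-- Lebesgue measure `dx₀ dx₁ dx₂ dx₃` on the quaternions. -/
def lebesgue : Measure ℍ :=
  Measure.map (fun p : ℝ × ℝ × ℝ × ℝ => ofCoords p.1 p.2.1 p.2.2.1 p.2.2.2) volume

/-- The standard area measure `dσ` of the unit sphere `𝕊` of imaginary units (total mass `4π`),
as a measure on `ℍ` carried by `𝕊`. -/
def sphereArea : Measure ℍ :=
  Measure.map
    (fun w : Metric.sphere (0 : EuclideanSpace ℝ (Fin 3)) 1 =>
      ofCoords 0 (w.1 0) (w.1 1) (w.1 2))
    (volume : Measure (EuclideanSpace ℝ (Fin 3))).toSphere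

/-- The sliced polar measure `r dr dθ dσ(I)`, `r > 0`, `0 < θ < 2π`, `I ∈ 𝕊`, transported to `ℍ`
by `q = r e^{Iθ} = r cos θ + I r sin θ`. -/
def polarMeasure : Measure ℍ :=
  Measure.map
    (fun p : ℝ × ℝ × ℍ => slicePt p.2.2 (p.1 * Real.cos p.2.1) (p.1 * Real.sin p.2.1))
    (((volume.restrict (Set.Ioi (0 : ℝ))).withDensity (fun r => ENNReal.ofReal r)).prod
      ((volume.restrict (Set.Ioo (0 : ℝ) (2 * Real.pi))).prod sphereArea))

/-- `L²(ℍ ∖ ℝ; e^{-|q|²} dν)`. -/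
def gaussL2 (ν : Measure ℍ) : Set (ℍ → ℍ) :=
  {f | MemLp f 2
    ((ν.restrict offReal).withDensity (fun q => ENNReal.ofReal (Real.exp (-‖q‖ ^ 2))))}

/-- The `L²`-eigenspace `{f ∈ L²(ℍ ∖ ℝ; e^{-|q|²} dν) : □_q f = f μ}`. Its elements are real
differentiable functions on `ℍ ∖ ℝ` that are of class `C²` on the slices. -/
def eigenspaceL2 (ν : Measure ℍ) (μ : ℍ) : Set (ℍ → ℍ) :=
  {f | f ∈ gaussL2 ν ∧ DifferentiableOn ℝ f offReal ∧ SliceContDiff 2 f offReal ∧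
    ∀ q ∈ offReal, box f q = f q * μ}

/-- The full hyperholomorphic Bargmann-Fock space: slice regular functions on `ℍ ∖ ℝ` that are
square integrable with respect to `e^{-|q|²} dν`. -/
def fullFock (ν : Measure ℍ) : Set (ℍ → ℍ) := sliceRegular offReal ∩ gaussL2 ν

/-- Functions on `ℍ ∖ ℝ` whose restriction to each slice `ℂ_I ∖ ℝ` has a limit at every point of
the real axis (the limit may depend on `I`). -/
def sliceExtendable : Set (ℍ → ℍ) :=
  {f | ∀ I ∈ imUnits, ∀ x : ℝ, ∃ l : ℍ,
    Tendsto (fun p : ℝ × ℝ => f (slicePt I p.1 p.2)) (𝓝[{p | p.2 ≠ 0}] (x, 0)) (𝓝 l)}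

/-- Real differentiable functions on `ℍ ∖ ℝ` of the form `f(q) = ∑ qⁿ C_n^I` for `q ∈ ℂ_I ∖ ℝ`,
with sliced constants such that `∑ n! ∫_𝕊 |C_n^I|² dσ(I) < ∞`. -/
def fockSeries : Set (ℍ → ℍ) :=
  {f | DifferentiableOn ℝ f offReal ∧ ∃ C : ℕ → ℍ → ℍ, (∀ n, Measurable (C n)) ∧
    (∀ I ∈ imUnits, ∀ x y : ℝ, y ≠ 0 →
      HasSum (fun n => slicePt I x y ^ n * C n I) (f (slicePt I x y))) ∧
    ∑' n : ℕ, (n.factorial : ℝ≥0∞) * ∫⁻ I, ‖C n I‖ₑ ^ 2 ∂sphereArea < ⊤}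

end

end SliceFock

namespace SliceFock

/-! On a slice `ℂ_I`, the maps `coord I p` are complex linear when `ℍ` is a complex space by left
multiplication by `I`. Through them a slice function becomes four scalar functions `φ`, regularity
becomes `∂̄φ = 0`, and `□` becomes `(-∂ + z̄)∂̄`. So regular functions are annihilated by `□`, and
the converse is where square integrability enters.

If `(-∂ + z̄)∂̄φ = 0` and `g = 2∂̄φ`, then `e^{-|z|²} g` is antiholomorphic; let `h` be its
conjugate. For a centre `a`, the function `F = φ e^{-āz}` satisfies `2∂̄F = e^{|z-a|²} conj H` with
`H` holomorphic and `H a = h a`. Stokes on annuli around `a` and the mean value property bound `|h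
a|` by the integral of `|F|` over a disc of radius 3 (`enorm_center_le_lintegral_ball`). As
`|e^{-āz}|` is comparable to `e^{-|a|²/2} e^{-|z|²/2}` there, the Gaussian norm of `φ` yields `|h a|
≤ C e^{-|a|²/2}` far from the real axis. A Phragmén–Lindelöf theorem then forces `h = 0`
(`eq_zero_of_gaussian_decay`, `dbar_eq_zero_of_lintegral_lt_top`).

Fubini gives a finite Gaussian norm only on almost every slice. Those slices are dense, and
holomorphy passes to the remaining ones as a locally uniform limit, because `f` is continuous off
`ℝ` (`differentiableOn_coord_of_mem_closure`).

For functions with limits on the real axis, Morera's theorem makes the components entire on each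
slice. Their Taylor coefficients are circle integrals, hence measurable in `I`. Parseval and `∫
r^{2n+1} e^{-r²} dr = n!/2` give `‖f‖² = π ∑ n! ∫ |C_n^I|² dσ` (`lintegral_polarMeasure_eq_tsum`),
which characterises the space in both directions. -/

/-! ### Stokes on annuli for `∂̄` with a Gaussian right-hand side. -/

-- This is the chain rule for `∂̄` under a holomorphic change of variable with derivative `c`; it
-- serves for the exponential.
open Complex ComplexConjugate Metric in
theorem wirtinger_smul (L : ℂ →L[ℝ] ℂ) (c : ℂ) :
    L c + I * L (I * c) = conj c * (L 1 + I * L I) := by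
  have h1 : L c = L (c.re • (1 : ℂ) + c.im • I) := by
    congr 1; apply Complex.ext <;> simp
  have h2 : I * c = (-c.im) • (1 : ℂ) + c.re • I := by
    apply Complex.ext <;> simp
  have h3 : conj c = c.re - c.im * I := by
    apply Complex.ext <;> simp
  rw [h1, h2, h3]
  simp only [map_add, map_smul]
  simp only [real_smul, ofReal_neg]
  ring_nf
  simp only [I_sq]
  ring

open Complex in
theorem integral_circle_eq_of_differentiableOn {H : ℂ → ℂ} {a : ℂ} {r : ℝ}
    (hH : ∀ z ∈ Metric.closedBall a |r|, DifferentiableAt ℂ H z) :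
    ∫ θ in (-Real.pi)..Real.pi, H (a + r * exp (θ * I)) = 2 * Real.pi * H a := by
  have hc : DiffContOnCl ℂ H (Metric.ball a |r|) := by
    apply DifferentiableOn.diffContOnCl
    intro z hz
    exact (hH z (Metric.closure_ball_subset_closedBall hz)).differentiableWithinAt
  have h := hc.circleAverage
  rw [Real.circleAverage_def] at h
  have hp : Function.Periodic (fun θ : ℝ => H (a + r * exp (θ * I))) (2 * Real.pi) := by
    intro θ
    simp [add_mul, exp_add, exp_two_pi_mul_I]
  have h2 := hp.intervalIntegral_add_eq (-Real.pi) 0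
  rw [show -Real.pi + 2 * Real.pi = Real.pi by ring, zero_add] at h2
  rw [h2]
  simp only [circleMap] at h
  rw [← h, real_smul, ← mul_assoc]
  push_cast
  rw [mul_inv_cancel₀ (by simp [Real.pi_ne_zero]), one_mul]

open Complex ComplexConjugate in
/-- Boundary integrals over two concentric circles of a solution of `∂̄F = ½ e^{|z-a|²} conj H`. -/
theorem integral_circle_sub_integral_circle {F H : ℂ → ℂ} {F' : ℂ → ℂ →L[ℝ] ℂ} {a : ℂ} {ρ R : ℝ}
    (hρ : 0 < ρ) (hR : ρ < R)
    (hF : ∀ z ∈ Metric.closedBall a R, HasFDerivAt F (F' z) z)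
    (hH : ∀ z ∈ Metric.closedBall a R, DifferentiableAt ℂ H z)
    (hFH : ∀ z ∈ Metric.closedBall a R,
      F' z 1 + I * F' z I = exp ((‖z - a‖ ^ 2 : ℝ)) * conj (H z)) :
    (∫ θ in (-Real.pi)..Real.pi, F (a + R * exp (θ * I)) * (R * exp (θ * I)))
      - ∫ θ in (-Real.pi)..Real.pi, F (a + ρ * exp (θ * I)) * (ρ * exp (θ * I))
      = conj (H a) * (Real.pi * (Real.exp (R ^ 2) - Real.exp (ρ ^ 2)) : ℝ) := by
  have hR0 : 0 < R := hρ.trans hR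
  have hlog : Real.log ρ ≤ Real.log R := Real.log_le_log hρ hR.le
  have hpi : -Real.pi ≤ Real.pi := by linarith [Real.pi_pos]
  -- In the coordinate `z = a + e^w` the annulus becomes the rectangle `[log ρ, log R] × [-π, π]`,
  -- to which Stokes for rectangles applies. The factor `e^w` is the Jacobian of `dz`.
  set f : ℂ → ℂ := fun w => F (a + exp w) * exp w with hf
  set f' : ℂ → ℂ →L[ℝ] ℂ := fun w =>
    F (a + exp w) • (exp w • (ContinuousLinearMap.id ℂ ℂ).restrictScalars ℝ)
    + exp w • ((F' (a + exp w)).comp (exp w • (ContinuousLinearMap.id ℂ ℂ).restrictScalars ℝ)) with hf'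
  have hexp : ∀ w : ℂ, w.re ≤ Real.log R → a + exp w ∈ Metric.closedBall a R := by
    intro w hw
    simp only [Metric.mem_closedBall, dist_eq_norm, add_sub_cancel_left, norm_exp]
    exact (Real.exp_le_exp.2 hw).trans (Real.exp_log hR0).le
  have hder : ∀ w : ℂ, w.re ≤ Real.log R → HasFDerivAt f (f' w) w := by
    intro w hw
    have h1 : HasFDerivAt (fun w : ℂ => exp w)
        (exp w • (ContinuousLinearMap.id ℂ ℂ).restrictScalars ℝ) w := by
      have := (Complex.hasDerivAt_exp w).hasFDerivAt.restrictScalars ℝ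
      refine this.congr_fderiv ?_
      ext v; simp [mul_comm]
    have h2 : HasFDerivAt (fun w : ℂ => F (a + exp w)) _ w :=
      (hF _ (hexp w hw)).comp w (h1.const_add a)
    exact h2.mul h1
  have hwirt : ∀ w : ℂ, w.re ≤ Real.log R → I • f' w 1 - f' w I
      = I * ((Real.exp (2 * w.re) * Real.exp (Real.exp (2 * w.re)) : ℝ) * conj (H (a + exp w))) := by
    intro w hw
    have e1 := wirtinger_smul (F' (a + exp w)) (exp w)
    rw [hFH _ (hexp w hw)] at e1
    have e2 : ‖a + exp w - a‖ ^ 2 = Real.exp (2 * w.re) := by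
      rw [add_sub_cancel_left, norm_exp, ← Real.exp_nat_mul]; norm_num
    have e3 : exp w * conj (exp w) = (Real.exp (2 * w.re) : ℝ) := by
      rw [mul_conj, normSq_eq_norm_sq, ← e2, add_sub_cancel_left]
    rw [e2] at e1
    simp only [hf', add_apply, smul_apply,
      ContinuousLinearMap.comp_apply, ContinuousLinearMap.coe_restrictScalars',
      ContinuousLinearMap.id_apply, smul_eq_mul, mul_one]
    have e4 : F' (a + exp w) (exp w) + I * F' (a + exp w) (exp w * I)
      = conj (exp w) * (exp ((Real.exp (2 * w.re) : ℝ)) * conj (H (a + exp w))) := by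
      rw [← e1, mul_comm (exp w) I]
    have : I * (F (a + exp w) * exp w + exp w * F' (a + exp w) (exp w))
        - (F (a + exp w) * (exp w * I) + exp w * F' (a + exp w) (exp w * I))
        = I * (exp w * (F' (a + exp w) (exp w) + I * F' (a + exp w) (exp w * I))) := by
      ring_nf; simp only [I_sq]; ring
    rw [this, e4, ← mul_assoc (exp w), e3]
    push_cast
    ring
  have key := integral_boundary_rect_of_continuousOn_of_hasFDerivAt_real f f'
    (⟨Real.log ρ, -Real.pi⟩ : ℂ) ⟨Real.log R, Real.pi⟩ ?_ ?_ ?_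
  rotate_left
  · intro w hw
    rw [mem_reProdIm, Set.uIcc_of_le hlog] at hw
    exact (hder w hw.1.2).continuousAt.continuousWithinAt
  · intro w hw
    rw [mem_reProdIm] at hw
    simp only [max_eq_right hlog] at hw
    exact hder w hw.1.2.le
  · have hcont : ContinuousOn (fun w : ℂ => I * ((Real.exp (2 * w.re) *
        Real.exp (Real.exp (2 * w.re)) : ℝ) * conj (H (a + exp w))))
        (Set.uIcc (Real.log ρ) (Real.log R) ×ℂ Set.uIcc (-Real.pi) Real.pi) := by
      intro w hw
      rw [mem_reProdIm, Set.uIcc_of_le hlog] at hw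
      have : ContinuousAt (fun w => H (a + exp w)) w :=
        ContinuousAt.comp (f := fun w => a + exp w) (hH _ (hexp w hw.1.2)).continuousAt (by fun_prop)
      have h2 : Continuous fun w : ℂ =>
          ((Real.exp (2 * w.re) * Real.exp (Real.exp (2 * w.re)) : ℝ) : ℂ) :=
        continuous_ofReal.comp (((Real.continuous_exp.comp (continuous_const.mul continuous_re))).mul
          (Real.continuous_exp.comp (Real.continuous_exp.comp (continuous_const.mul continuous_re))))
      exact (continuousAt_const.mul
        (h2.continuousAt.mul (continuous_conj.continuousAt.comp this))).continuousWithinAt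
    refine (hcont.integrableOn_compact (isCompact_uIcc.reProdIm isCompact_uIcc)).congr_fun ?_ ?_
    · intro w hw
      rw [mem_reProdIm, Set.uIcc_of_le hlog] at hw
      exact (hwirt w hw.1.2).symm
    · exact (isCompact_uIcc.reProdIm isCompact_uIcc).measurableSet
  -- The two horizontal edges are the same radial cut, so their contributions cancel.
  have hedge : ∀ x : ℝ, f (x + ((-Real.pi : ℝ) : ℂ) * I) = f (x + (Real.pi : ℂ) * I) := by
    intro x
    have : exp (x + ((-Real.pi : ℝ) : ℂ) * I) = exp (x + (Real.pi : ℂ) * I) := by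
      rw [exp_add, exp_add]
      simp [exp_neg, exp_pi_mul_I]
    simp only [hf, this]
  have hval : ∀ r : ℝ, 0 < r → ∀ y : ℝ, f ((Real.log r : ℝ) + y * I)
      = F (a + r * exp (y * I)) * (r * exp (y * I)) := by
    intro r hr y
    have : exp ((Real.log r : ℝ) + y * I) = r * exp (y * I) := by
      rw [exp_add, ← ofReal_exp, Real.exp_log hr]
    simp only [hf, this]
  simp only [hedge, sub_self, zero_add, hval R hR0, hval ρ hρ] at key
  have hrhs : ∫ x in (Real.log ρ)..(Real.log R), ∫ y in (-Real.pi)..Real.pi,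
      I • f' (x + y * I) 1 - f' (x + y * I) I
      = I * (conj (H a) * (Real.pi * (Real.exp (R ^ 2) - Real.exp (ρ ^ 2)) : ℝ)) := by
    -- On each circle the Gaussian weight is constant, so the mean value property replaces `H` by `H
    -- a`; what remains is the derivative of `exp (exp (2x))`, up to constants.
    have inner : ∀ x ∈ Set.uIcc (Real.log ρ) (Real.log R), ∫ y in (-Real.pi)..Real.pi,
      I • f' (x + y * I) 1 - f' (x + y * I) I
      = (I * conj (H a) * Real.pi) * ((2 * Real.exp (2 * x) * Real.exp (Real.exp (2 * x)) : ℝ) : ℂ) := by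
      intro x hx
      rw [Set.uIcc_of_le hlog] at hx
      have e1 : ∀ y : ℝ, I • f' (x + y * I) 1 - f' (x + y * I) I
        = I * ((Real.exp (2 * x) * Real.exp (Real.exp (2 * x)) : ℝ) : ℂ) *
          conj (H (a + (Real.exp x : ℝ) * exp (y * I))) := by
        intro y
        have := hwirt (x + y * I) (by simpa using hx.2)
        rw [this, exp_add, ofReal_exp]
        simp [mul_assoc]
      simp only [e1]
      rw [intervalIntegral.integral_const_mul, intervalIntegral.integral_of_le hpi, integral_conj,
        ← intervalIntegral.integral_of_le hpi,
        integral_circle_eq_of_differentiableOn]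
      · simp only [map_mul, conj_ofReal]
        push_cast
        simp only [map_ofNat]
        ring
      · intro z hz
        apply hH z
        refine Metric.closedBall_subset_closedBall ?_ hz
        rw [abs_of_pos (Real.exp_pos _)]
        exact (Real.exp_le_exp.2 hx.2).trans (Real.exp_log hR0).le
    rw [intervalIntegral.integral_congr inner, intervalIntegral.integral_const_mul,
      intervalIntegral.integral_ofReal]
    have : ∫ x in (Real.log ρ)..(Real.log R), 2 * Real.exp (2 * x) * Real.exp (Real.exp (2 * x))
        = Real.exp (R ^ 2) - Real.exp (ρ ^ 2) := by
      have hh : ∀ r : ℝ, 0 < r → r ^ 2 = Real.exp (2 * Real.log r) := by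
        intro r hr
        rw [show 2 * Real.log r = ((2 : ℕ) : ℝ) * Real.log r by norm_num, Real.exp_nat_mul,
          Real.exp_log hr]
      rw [hh R hR0, hh ρ hρ]
      refine intervalIntegral.integral_eq_sub_of_hasDerivAt
        (f := fun x => Real.exp (Real.exp (2 * x))) (fun x _ => ?_)
        (Continuous.intervalIntegrable (by fun_prop) _ _)
      have := (((hasDerivAt_id x).const_mul 2).exp).exp
      refine this.congr_deriv ?_
      simp; ring
    rw [this]
    push_cast
    ring
  rw [hrhs, smul_eq_mul, smul_eq_mul, ← mul_sub] at key
  exact mul_left_cancel₀ I_ne_zero key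

open Complex in
theorem lintegral_circles_le_lintegral_ball {G : ℂ → ℝ≥0∞} {a : ℂ}
    (hG : AEMeasurable (fun p : ℝ × ℝ => ENNReal.ofReal p.1 * G (a + p.1 * exp (p.2 * I)))
      ((volume.restrict (Set.Ioo 0 3)).prod (volume.restrict (Set.Ioo (-Real.pi) Real.pi)))) :
    ∫⁻ r in Set.Ioo (0 : ℝ) 3, ∫⁻ θ in Set.Ioo (-Real.pi) Real.pi,
      ENNReal.ofReal r * G (a + r * exp (θ * I)) ≤ ∫⁻ z in Metric.ball (0 : ℂ) 3, G (a + z) := by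
  rw [lintegral_lintegral (f := fun r θ : ℝ => ENNReal.ofReal r * G (a + r * exp (θ * I))) hG,
    Measure.prod_restrict, ← lintegral_indicator measurableSet_ball,
    ← Complex.lintegral_comp_polarCoord_symm, ← Measure.volume_eq_prod, polarCoord_target]
  refine le_trans (le_of_eq ?_) (lintegral_mono_set (Set.prod_mono (s₁ := Set.Ioo 0 3)
    (fun r hr => hr.1) le_rfl))
  refine setLIntegral_congr_fun (measurableSet_Ioo.prod measurableSet_Ioo) ?_
  rintro ⟨r, θ⟩ ⟨hr, hθ⟩
  have e : Complex.polarCoord.symm (r, θ) = r * exp (θ * I) := by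
    rw [Complex.polarCoord_symm_apply, exp_mul_I, ofReal_cos, ofReal_sin]
  simp only [e, smul_eq_mul]
  rw [Set.indicator_of_mem]
  simp only [mem_ball_zero_iff, norm_mul, norm_real, norm_exp_ofReal_mul_I, mul_one]
  rw [Real.norm_of_nonneg hr.1.le]
  exact hr.2

-- Averaging the two-circle identity over `ρ ∈ (0, 1)` with `R = ρ + 2` turns circle integrals into
-- area integrals. The radii sweep `(0, 1)` and `(2, 3)`; each family is bounded by the full disc of
-- radius 3, whence the factor 2.
open Complex ComplexConjugate in
theorem enorm_center_le_lintegral_ball {F H : ℂ → ℂ} {F' : ℂ → ℂ →L[ℝ] ℂ} {a : ℂ}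
    (hF : ∀ z ∈ Metric.closedBall a 3, HasFDerivAt F (F' z) z)
    (hH : ∀ z ∈ Metric.closedBall a 3, DifferentiableAt ℂ H z)
    (hFH : ∀ z ∈ Metric.closedBall a 3,
      F' z 1 + I * F' z I = exp ((‖z - a‖ ^ 2 : ℝ)) * conj (H z)) :
    ‖H a‖ₑ ≤ 2 * ∫⁻ z in Metric.ball (0 : ℂ) 3, ‖F (a + z)‖ₑ := by
  have hpi : -Real.pi ≤ Real.pi := by linarith [Real.pi_pos]
  set N : ℝ → ℝ≥0∞ := fun r => ∫⁻ θ in Set.Ioo (-Real.pi) Real.pi,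
    ENNReal.ofReal r * ‖F (a + r * exp (θ * I))‖ₑ with hN
  have hcirc : ∀ r : ℝ, 0 < r → ‖∫ θ in (-Real.pi)..Real.pi,
      F (a + r * exp (θ * I)) * (r * exp (θ * I))‖ₑ ≤ N r := by
    intro r hr
    rw [intervalIntegral.integral_of_le hpi, integral_Ioc_eq_integral_Ioo]
    refine (enorm_integral_le_lintegral_enorm _).trans (le_of_eq ?_)
    refine lintegral_congr fun θ => ?_
    rw [enorm_mul, enorm_mul, mul_comm]
    congr 1
    have : ‖exp (θ * I)‖ₑ = 1 := by
      rw [← ofReal_norm, norm_exp_ofReal_mul_I]; simp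
    rw [this, mul_one, ← ofReal_norm, norm_real, Real.norm_of_nonneg hr.le]
  have hpt : ∀ ρ ∈ Set.Ioo (0 : ℝ) 1, ‖H a‖ₑ ≤ N (ρ + 2) + N ρ := by
    intro ρ hρ
    have hsub : Metric.closedBall a (ρ + 2) ⊆ Metric.closedBall a 3 :=
      Metric.closedBall_subset_closedBall (by linarith [hρ.2])
    have h := integral_circle_sub_integral_circle (R := ρ + 2) hρ.1 (by linarith)
      (fun z hz => hF z (hsub hz)) (fun z hz => hH z (hsub hz)) (fun z hz => hFH z (hsub hz))
    -- Since `(ρ + 2)² ≥ 4` the first exponential is at least 5, while the second is at most `e`;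
    -- the gap of radii makes the constant harmless.
    have h1 : 1 ≤ Real.pi * (Real.exp ((ρ + 2) ^ 2) - Real.exp (ρ ^ 2)) := by
      have e1 : Real.exp (ρ ^ 2) ≤ Real.exp 1 :=
        Real.exp_le_exp.2 (by nlinarith [hρ.1, hρ.2])
      have e2 : (ρ + 2) ^ 2 + 1 ≤ Real.exp ((ρ + 2) ^ 2) := Real.add_one_le_exp _
      nlinarith [Real.exp_one_lt_d9, Real.pi_gt_three, hρ.1]
    calc ‖H a‖ₑ ≤ ‖conj (H a) *
          (Real.pi * (Real.exp ((ρ + 2) ^ 2) - Real.exp (ρ ^ 2)) : ℝ)‖ₑ := by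
            rw [enorm_le_iff_norm_le, norm_mul, RCLike.norm_conj, norm_real, Real.norm_eq_abs]
            exact le_mul_of_one_le_right (norm_nonneg _) (h1.trans (le_abs_self _))
      _ ≤ _ := by
            rw [← h]
            exact enorm_sub_le.trans
              (add_le_add (hcirc _ (by linarith [hρ.1])) (hcirc _ hρ.1))
  have hmeas : AEMeasurable
      (fun p : ℝ × ℝ => ENNReal.ofReal p.1 * ‖F (a + p.1 * exp (p.2 * I))‖ₑ)
      ((volume.restrict (Set.Ioo 0 3)).prod (volume.restrict (Set.Ioo (-Real.pi) Real.pi))) := by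
    rw [Measure.prod_restrict, ← Measure.volume_eq_prod]
    have hc : ContinuousOn (fun p : ℝ × ℝ => F (a + p.1 * exp (p.2 * I)))
        (Set.Ioo 0 3 ×ˢ Set.Ioo (-Real.pi) Real.pi) := by
      intro p hp
      have h1 : ContinuousAt F (a + p.1 * exp (p.2 * I)) := by
        refine (hF _ ?_).continuousAt
        simp only [Metric.mem_closedBall, dist_eq_norm, add_sub_cancel_left, norm_mul, norm_real,
          norm_exp_ofReal_mul_I, mul_one]
        rw [Real.norm_of_nonneg hp.1.1.le]
        exact hp.1.2.le
      have h2 : Continuous fun p : ℝ × ℝ => a + p.1 * exp (p.2 * I) := by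
        exact continuous_const.add ((continuous_ofReal.comp continuous_fst).mul
          (continuous_exp.comp ((continuous_ofReal.comp continuous_snd).mul continuous_const)))
      exact (ContinuousAt.comp (f := fun p : ℝ × ℝ => a + p.1 * exp (p.2 * I)) h1
        h2.continuousAt).continuousWithinAt
    exact ((ENNReal.measurable_ofReal.comp measurable_fst).aemeasurable).mul
      (hc.aemeasurable (measurableSet_Ioo.prod measurableSet_Ioo)).enorm
  have hNmeas : AEMeasurable N (volume.restrict (Set.Ioo 0 3)) := hmeas.lintegral_prod_right'
  have hle : ∫⁻ r in Set.Ioo (0 : ℝ) 3, N r ≤ ∫⁻ z in Metric.ball (0 : ℂ) 3, ‖F (a + z)‖ₑ :=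
    lintegral_circles_le_lintegral_ball (G := fun z => ‖F z‖ₑ) hmeas
  have hshift : ∫⁻ ρ in Set.Ioo (0 : ℝ) 1, N (ρ + 2) ≤ ∫⁻ r in Set.Ioo (0 : ℝ) 3, N r := by
    rw [← lintegral_indicator measurableSet_Ioo, ← lintegral_indicator measurableSet_Ioo,
      ← lintegral_add_right_eq_self ((Set.Ioo (0 : ℝ) 3).indicator N) 2]
    refine lintegral_mono fun ρ => ?_
    by_cases hρ : ρ ∈ Set.Ioo (0 : ℝ) 1
    · rw [Set.indicator_of_mem hρ,
        Set.indicator_of_mem (show ρ + 2 ∈ Set.Ioo (0 : ℝ) 3 from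
          ⟨by linarith [hρ.1], by linarith [hρ.2]⟩)]
    · simp [Set.indicator_of_notMem hρ]
  have hsub : Set.Ioo (0 : ℝ) 1 ⊆ Set.Ioo 0 3 := Set.Ioo_subset_Ioo_right (by norm_num)
  calc ‖H a‖ₑ = ∫⁻ _ in Set.Ioo (0 : ℝ) 1, ‖H a‖ₑ := by simp
    _ ≤ ∫⁻ ρ in Set.Ioo (0 : ℝ) 1, (N (ρ + 2) + N ρ) :=
        setLIntegral_mono' measurableSet_Ioo hpt
    _ = (∫⁻ ρ in Set.Ioo (0 : ℝ) 1, N (ρ + 2)) + ∫⁻ ρ in Set.Ioo (0 : ℝ) 1, N ρ :=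
        lintegral_add_right' _ (hNmeas.mono_measure (Measure.restrict_mono hsub le_rfl))
    _ ≤ _ := by
        rw [two_mul]
        exact add_le_add (hshift.trans hle) ((lintegral_mono_set hsub).trans hle)

/-! ### Gaussian decay and the vanishing of `∂̄φ` on the half plane. -/

open Complex ComplexConjugate in
/-- A holomorphic function on the upper half plane bounded by `C e^{-|z|²/2}` far up vanishes. -/
theorem eq_zero_of_gaussian_decay {h : ℂ → ℂ} {C : ℝ}
    (hd : DifferentiableOn ℂ h {z | 0 < z.im})
    (hb : ∀ z : ℂ, 4 < z.im → ‖h z‖ ≤ C * Real.exp (-‖z‖ ^ 2 / 2)) :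
    ∀ z : ℂ, 0 < z.im → h z = 0 := by
  have hU : IsOpen {z : ℂ | 0 < z.im} := isOpen_lt continuous_const continuous_im
  have hC : 0 ≤ C := by
    have := (norm_nonneg _).trans (hb (5 * I) (by norm_num))
    exact nonneg_of_mul_nonneg_left this (Real.exp_pos _)
  -- The map `w ↦ iw + 5i` carries the closed right half plane into `Im z ≥ 5`, well inside the
  -- region where the bound is available.
  set k : ℂ → ℂ := fun w => h (I * w + 5 * I) with hk
  have him : ∀ w : ℂ, (I * w + 5 * I).im = w.re + 5 := by intro w; simp
  have hkd : ∀ w : ℂ, -1 < w.re → DifferentiableAt ℂ k w := by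
    intro w hw
    have : DifferentiableAt ℂ h (I * w + 5 * I) :=
      (hd _ (by rw [Set.mem_ofPred_eq, him]; linarith)).differentiableAt
        (hU.mem_nhds (by rw [Set.mem_ofPred_eq, him]; linarith))
    exact this.comp (f := fun w => I * w + 5 * I) w (by fun_prop)
  have hkb : ∀ w : ℂ, 0 ≤ w.re → ‖k w‖ ≤ C * Real.exp (-‖I * w + 5 * I‖ ^ 2 / 2) :=
    fun w hw => hb _ (by rw [him]; linarith)
  have hkC : ∀ w : ℂ, 0 ≤ w.re → ‖k w‖ ≤ C := fun w hw =>
    (hkb w hw).trans (mul_le_of_le_one_right hC (Real.exp_le_one_iff.2 (by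
      have := sq_nonneg ‖I * w + 5 * I‖; linarith)))
  have hz : Set.EqOn k 0 {z : ℂ | 0 ≤ z.re} := by
    apply PhragmenLindelof.eq_zero_on_right_half_plane_of_superexponential_decay
    · apply DifferentiableOn.diffContOnCl
      intro z hz
      have : (0 : ℝ) ≤ z.re := by
        have := closure_lt_subset_le continuous_const continuous_re hz
        exact this
      exact (hkd z (by linarith)).differentiableWithinAt
    · refine ⟨1, by norm_num, 0, ?_⟩
      refine Asymptotics.IsBigO.of_bound C ?_
      rw [eventually_inf_principal]
      filter_upwards with z hz
      simpa using hkC z (le_of_lt hz)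
    · intro n
      refine squeeze_zero_norm' (a := fun x : ℝ => C * Real.exp (-x)) (f := _) ?_ ?_
      -- For `x ≥ 2n + 2` one has `nx - x²/2 ≤ -x`, so Gaussian decay beats every exponential.
      · filter_upwards [eventually_ge_atTop (2 * n + 2 : ℝ)] with x hx
        have hx0 : 0 ≤ x := le_trans (by positivity) hx
        rw [norm_mul, norm_norm, norm_pow, Real.norm_of_nonneg (Real.exp_pos _).le,
          ← Real.exp_nat_mul]
        have hn : x ≤ ‖I * (x : ℂ) + 5 * I‖ := by
          have := abs_im_le_norm (I * (x : ℂ) + 5 * I)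
          rw [him, ofReal_re] at this
          linarith [le_abs_self (x + 5)]
        calc Real.exp (n * x) * ‖k x‖ ≤ Real.exp (n * x) *
              (C * Real.exp (-‖I * (x : ℂ) + 5 * I‖ ^ 2 / 2)) := by
                gcongr; exact hkb _ (by simpa using hx0)
          _ = C * Real.exp (n * x + -‖I * (x : ℂ) + 5 * I‖ ^ 2 / 2) := by
                rw [Real.exp_add]; ring
          _ ≤ C * Real.exp (-x) := by
                gcongr
                have : x ^ 2 ≤ ‖I * (x : ℂ) + 5 * I‖ ^ 2 := by gcongr
                nlinarith
      · have := (Real.tendsto_exp_neg_atTop_nhds_zero).const_mul C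
        simpa using this
    · refine ⟨C, fun x => hkC _ (by simp)⟩
  have hconn : IsPreconnected {z : ℂ | 0 < z.im} := by
    have : Convex ℝ {z : ℂ | 0 < z.im} := convex_halfSpace_im_gt 0
    exact this.isPreconnected
  -- So far `h` vanishes only high up; the identity theorem spreads this to the whole half plane
  -- from a neighbourhood of `6i`.
  have hev : h =ᶠ[𝓝 (6 * I)] 0 := by
    have : {z : ℂ | 5 < z.im} ∈ 𝓝 (6 * I) :=
      (isOpen_lt continuous_const continuous_im).mem_nhds (by norm_num)
    filter_upwards [this] with z hz5
    have := hz (show -I * (z - 5 * I) ∈ {z : ℂ | 0 ≤ z.re} by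
      have : (5 : ℝ) < z.im := hz5
      simp; linarith)
    have e : I * (-I * (z - 5 * I)) + 5 * I = z := by
      linear_combination (5 * I - z) * I_sq
    simp only [hk, e] at this
    exact this
  exact fun z hz => (hd.analyticOnNhd hU).eqOn_zero_of_preconnected_of_eventuallyEq_zero hconn
    (z₀ := 6 * I) (by simp) hev hz

open Complex ComplexConjugate in
/-- On the upper half plane, a function in `L²(e^{-|z|²})` (away from the boundary) annihilated by
`(-∂ + z̄)∂̄` is holomorphic. Here `g = 2∂̄φ`. -/
theorem dbar_eq_zero_of_lintegral_lt_top {φ g : ℂ → ℂ} {φ' g' : ℂ → ℂ →L[ℝ] ℂ}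
    (hφ : ∀ z : ℂ, 0 < z.im → HasFDerivAt φ (φ' z) z)
    (hg : ∀ z : ℂ, 0 < z.im → HasFDerivAt g (g' z) z)
    (hgφ : ∀ z : ℂ, 0 < z.im → φ' z 1 + I * φ' z I = g z)
    (hbox : ∀ z : ℂ, 0 < z.im → g' z 1 - I * g' z I = 2 * conj z * g z)
    (hfin : ∫⁻ z in {z : ℂ | 1 < z.im}, ‖φ z‖ₑ ^ 2 * ENNReal.ofReal (Real.exp (-‖z‖ ^ 2)) < ⊤) :
    ∀ z : ℂ, 0 < z.im → g z = 0 := by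
  have hU : IsOpen {z : ℂ | 0 < z.im} := isOpen_lt continuous_const continuous_im
  set K : ℂ → ℂ := fun z => exp (-(z * conj z)) * g z with hK
  set h : ℂ → ℂ := fun z => conj (K z) with hh
  have hconj : ∀ z : ℂ, HasFDerivAt (fun w : ℂ => conj w) (conjCLE : ℂ →L[ℝ] ℂ) z :=
    fun z => conjCLE.hasFDerivAt
  have hhd : DifferentiableOn ℂ h {z | 0 < z.im} := by
    intro z hz
    apply DifferentiableAt.differentiableWithinAt
    rw [differentiableAt_complex_iff_differentiableAt_real]
    have h1 := (((hasFDerivAt_id (𝕜 := ℝ) z).mul (hconj z)).neg.cexp).mul (hg z hz)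
    have h2 := (hconj (K z)).comp z h1
    refine ⟨h2.differentiableAt, ?_⟩
    have h3 : fderiv ℝ h z = _ := h2.fderiv
    rw [h3]
    -- The equation says `∂g = z̄ g`, hence `∂(e^{-|z|²} g) = 0`; conjugating gives the
    -- Cauchy–Riemann equation for `h`.
    have hb := hbox z hz
    simp only [ContinuousLinearMap.comp_apply, add_apply, smul_apply, neg_apply,
      ContinuousLinearMap.id_apply, smul_eq_mul, ContinuousLinearEquiv.coe_coe, conjCLE_apply,
      Pi.neg_apply, Pi.mul_apply, id]
    have e : I * conj (exp (-(z * conj z)) * g' z 1 +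
          g z * (exp (-(z * conj z)) * -(z * conj 1 + conj z * 1))) =
        conj (-I * (exp (-(z * conj z)) * g' z 1 +
          g z * (exp (-(z * conj z)) * -(z * conj 1 + conj z * 1)))) := by
      rw [map_mul (starRingEnd ℂ) (-I), map_neg, conj_I, neg_neg]
    rw [e]
    congr 1
    simp only [map_one, conj_I]
    linear_combination (I * exp (-(z * conj z))) * hb +
      (exp (-(z * conj z)) * g' z I) * I_sq
  obtain ⟨M, hM⟩ : ∃ M : ℝ≥0∞, M = ∫⁻ z in {z : ℂ | 1 < z.im},
      ‖φ z‖ₑ ^ 2 * ENNReal.ofReal (Real.exp (-‖z‖ ^ 2)) := ⟨_, rfl⟩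
  rw [← hM] at hfin
  set V : ℝ≥0∞ := volume (Metric.ball (0 : ℂ) 3) with hV
  have hVtop : V < ⊤ := measure_ball_lt_top
  have hdecay : ∀ a : ℂ, 4 < a.im →
      ‖h a‖ ≤ (2 * Real.exp (9 / 2) * (V + M).toReal) * Real.exp (-‖a‖ ^ 2 / 2) := by
    intro a ha
    set D : ℝ := Real.exp (9 / 2) * Real.exp (-‖a‖ ^ 2 / 2) with hD
    -- The holomorphic factor `e^{-āz}` commutes with `∂̄` and recentres the Gaussian: `|z|² - āz =
    -- |z - a|² + a z̄ - |a|²`. The last two terms are absorbed in `H`.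
    set F : ℂ → ℂ := fun z => φ z * exp (-(conj a * z)) with hF
    set H : ℂ → ℂ := fun z => exp (conj a * z - a * conj a) * h z with hH
    -- The threshold 4 is the radius 3 plus the height 1 above which the Gaussian norm is assumed
    -- finite.
    have hball : ∀ z ∈ Metric.closedBall a 3, 1 < z.im := by
      intro z hz
      rw [Metric.mem_closedBall, dist_eq_norm] at hz
      have := (abs_im_le_norm (z - a)).trans hz
      rw [sub_im, abs_le] at this
      linarith [this.1]
    have key : ‖H a‖ₑ ≤ 2 * ∫⁻ z in Metric.ball (0 : ℂ) 3, ‖F (a + z)‖ₑ := by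
      have hFd : ∀ z ∈ Metric.closedBall a 3, HasFDerivAt F
          (φ z • (exp (-(conj a * z)) • -(conj a • ContinuousLinearMap.id ℝ ℂ))
            + exp (-(conj a * z)) • φ' z) z := by
        intro z hz
        exact (hφ z (by linarith [hball z hz])).mul
          (((hasFDerivAt_id (𝕜 := ℝ) z).const_mul (conj a)).neg.cexp)
      refine enorm_center_le_lintegral_ball hFd ?_ ?_
      · intro z hz
        have := (hhd z (show 0 < z.im by linarith [hball z hz])).differentiableAt
          (hU.mem_nhds (show 0 < z.im by linarith [hball z hz]))
        exact DifferentiableAt.mul (by fun_prop) this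
      · intro z hz
        have e1 := hgφ z (by linarith [hball z hz])
        have e2 : ((‖z - a‖ ^ 2 : ℝ) : ℂ) = (z - a) * (conj z - conj a) := by
          rw [← map_sub, mul_conj, normSq_eq_norm_sq]
        have e3 : exp (-(conj a * z)) * g z = exp ((‖z - a‖ ^ 2 : ℝ)) * conj (H z) := by
          simp only [hH, hh, hK, map_mul, conj_conj, ← exp_conj, map_sub, e2]
          rw [← mul_assoc, ← mul_assoc, ← exp_add, ← exp_add]
          congr 2
          ring
        rw [← e3, ← e1]
        simp only [add_apply, smul_apply, neg_apply, ContinuousLinearMap.id_apply, smul_eq_mul]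
        linear_combination (-(φ z * exp (-(conj a * z)) * conj a)) * I_sq
    have hHa : H a = h a := by simp [hH, mul_comm]
    have hFb : ∀ z ∈ Metric.ball (0 : ℂ) 3, ‖F (a + z)‖ₑ ≤ ENNReal.ofReal D *
        (1 + ({z : ℂ | 1 < z.im}).indicator
          (fun z => ‖φ z‖ₑ ^ 2 * ENNReal.ofReal (Real.exp (-‖z‖ ^ 2))) (a + z)) := by
      intro z hz
      rw [mem_ball_zero_iff] at hz
      have hmem : a + z ∈ {z : ℂ | 1 < z.im} := hball _ (by simpa [dist_eq_norm] using hz.le)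
      rw [Set.indicator_of_mem hmem]
      have e1 : ‖F (a + z)‖ ≤ D * (1 + ‖φ (a + z)‖ ^ 2 * Real.exp (-‖a + z‖ ^ 2)) := by
        set w := a + z with hw
        have ew : Real.exp (-‖w‖ ^ 2) = Real.exp (-‖w‖ ^ 2 / 2) ^ 2 := by
          rw [← Real.exp_nat_mul]; congr 1; push_cast; ring
        -- By polarisation `-2 Re(āw) = |w - a|² - |w|² - |a|²`, and `|w - a| < 3` accounts for the
        -- constant 9/2.
        have e2 : (-(conj a * w)).re ≤ 9 / 2 + -‖a‖ ^ 2 / 2 + -‖w‖ ^ 2 / 2 := by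
          have e3 : ‖z‖ ^ 2 = ‖w‖ ^ 2 + ‖a‖ ^ 2 - 2 * (conj a * w).re := by
            rw [show z = w - a by rw [hw]; ring, ← normSq_eq_norm_sq, ← normSq_eq_norm_sq,
              ← normSq_eq_norm_sq, normSq_sub]
            rw [mul_comm w]
          have : ‖z‖ ^ 2 ≤ 9 := by nlinarith [norm_nonneg z]
          rw [neg_re]; linarith
        have e4 : ‖F w‖ ≤ ‖φ w‖ * (D * Real.exp (-‖w‖ ^ 2 / 2)) := by
          simp only [hF, norm_mul, norm_exp, hD]
          rw [← Real.exp_add, ← Real.exp_add]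
          gcongr
        -- The inequality `t ≤ 1 + t²` with `t = |φ(w)| e^{-|w|²/2}` passes from an `L¹` to an `L²`
        -- bound; the 1 contributes the area of the disc.
        refine e4.trans ?_
        rw [ew]
        have : 0 ≤ D := by positivity
        nlinarith [mul_nonneg this (sq_nonneg (‖φ w‖ * Real.exp (-‖w‖ ^ 2 / 2) - 1)),
          mul_nonneg this (sq_nonneg (‖φ w‖ * Real.exp (-‖w‖ ^ 2 / 2)))]
      rw [← ofReal_norm]
      refine (ENNReal.ofReal_le_ofReal e1).trans (le_of_eq ?_)
      rw [ENNReal.ofReal_mul (p := D) (by positivity), ENNReal.ofReal_add (by norm_num) (by positivity),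
        ENNReal.ofReal_mul (p := ‖φ (a + z)‖ ^ 2) (by positivity), ENNReal.ofReal_pow (norm_nonneg _), ofReal_norm,
        ENNReal.ofReal_one]
    have hint : ∫⁻ z in Metric.ball (0 : ℂ) 3, ‖F (a + z)‖ₑ ≤ ENNReal.ofReal D * (V + M) := by
      refine (setLIntegral_mono' measurableSet_ball hFb).trans ?_
      rw [lintegral_const_mul' _ _ ENNReal.ofReal_ne_top, lintegral_add_left measurable_const,
        lintegral_one, Measure.restrict_apply_univ]
      gcongr
      refine (setLIntegral_le_lintegral _ _).trans ?_
      rw [lintegral_add_left_eq_self (μ := volume) (({z : ℂ | 1 < z.im}).indicator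
          (fun z => ‖φ z‖ₑ ^ 2 * ENNReal.ofReal (Real.exp (-‖z‖ ^ 2)))) a,
        lintegral_indicator (isOpen_lt continuous_const continuous_im).measurableSet, hM]
    rw [hHa] at key
    have hfinal : ‖h a‖ₑ ≤ 2 * (ENNReal.ofReal D * (V + M)) := key.trans (by gcongr)
    have htop : V + M ≠ ⊤ := (ENNReal.add_lt_top.2 ⟨hVtop, hfin⟩).ne
    have := ENNReal.toReal_mono (ENNReal.mul_ne_top (by simp)
      (ENNReal.mul_ne_top ENNReal.ofReal_ne_top htop)) hfinal
    rw [toReal_enorm, ENNReal.toReal_mul, ENNReal.toReal_mul,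
      ENNReal.toReal_ofReal (by positivity)] at this
    refine this.trans (le_of_eq ?_)
    simp [hD]; ring
  intro z hz
  have := eq_zero_of_gaussian_decay hhd hdecay z hz
  simpa [hh, hK] using this

/-! ### Imaginary units, slices and complex coordinates on `ℍ`. -/

theorem imUnits_re {I : ℍ} (hI : I ∈ imUnits) : I.re = 0 := by
  have h : I * I = -1 := hI
  have h0 := congrArg (·.re) h
  have h1 := congrArg (·.imI) h
  have h2 := congrArg (·.imJ) h
  have h3 := congrArg (·.imK) h
  simp at h0 h1 h2 h3
  by_contra hne
  have e1 : I.imI = 0 := by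
    have : I.re * I.imI = 0 := by linarith
    simpa [hne] using this
  have e2 : I.imJ = 0 := by
    have : I.re * I.imJ = 0 := by linarith
    simpa [hne] using this
  have e3 : I.imK = 0 := by
    have : I.re * I.imK = 0 := by linarith
    simpa [hne] using this
  rw [e1, e2, e3] at h0
  nlinarith [mul_self_nonneg I.re]

theorem imUnits_sq {I : ℍ} (hI : I ∈ imUnits) : I.imI ^ 2 + I.imJ ^ 2 + I.imK ^ 2 = 1 := by
  have h0 := congrArg (·.re) (show I * I = -1 from hI)
  simp [imUnits_re hI] at h0
  nlinarith

theorem mem_imUnits_iff {I : ℍ} :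
    I ∈ imUnits ↔ I.re = 0 ∧ I.imI ^ 2 + I.imJ ^ 2 + I.imK ^ 2 = 1 := by
  refine ⟨fun h => ⟨imUnits_re h, imUnits_sq h⟩, fun ⟨h0, h⟩ => ?_⟩
  show I * I = -1
  ext <;> simp [h0] <;> nlinarith

theorem norm_sq_eq (q : ℍ) : ‖q‖ ^ 2 = q.re ^ 2 + q.imI ^ 2 + q.imJ ^ 2 + q.imK ^ 2 := by
  rw [sq, ← Quaternion.normSq_eq_norm_mul_self, Quaternion.normSq_def']

theorem norm_imUnits {I : ℍ} (hI : I ∈ imUnits) : ‖I‖ = 1 := by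
  have h := norm_sq_eq I
  rw [imUnits_re hI] at h
  have h2 := imUnits_sq hI
  have : ‖I‖ ^ 2 = 1 := by linarith
  nlinarith [norm_nonneg I]

theorem neg_mem_imUnits {I : ℍ} (hI : I ∈ imUnits) : -I ∈ imUnits := by
  show -I * -I = -1
  rw [neg_mul_neg]; exact hI

/-- The point of the slice `ℂ_I` with complex coordinate `z`. -/
noncomputable def sl (I : ℍ) (z : ℂ) : ℍ := slicePt I z.re z.im

theorem slicePt_neg_neg (I : ℍ) (x y : ℝ) : slicePt (-I) x (-y) = slicePt I x y := by
  simp [slicePt]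

theorem continuous_slicePt : Continuous fun p : ℝ × ℝ × ℍ => slicePt p.2.2 p.1 p.2.1 := by
  unfold slicePt
  exact (Quaternion.continuous_coe.comp continuous_fst).add (by fun_prop)

theorem continuous_sl_uncurry : Continuous fun p : ℍ × ℂ => sl p.1 p.2 :=
  continuous_slicePt.comp ((Complex.continuous_re.comp continuous_snd).prodMk
    ((Complex.continuous_im.comp continuous_snd).prodMk continuous_fst))

theorem continuous_sl (I : ℍ) : Continuous (sl I) :=
  continuous_sl_uncurry.comp (continuous_const.prodMk continuous_id)

theorem slicePt_im {I : ℍ} (hI : I ∈ imUnits) (x y : ℝ) : (slicePt I x y).im = y • I := by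
  have := imUnits_re hI
  ext <;> simp [slicePt, this]

theorem slicePt_re {I : ℍ} (hI : I ∈ imUnits) (x y : ℝ) : (slicePt I x y).re = x := by
  simp [slicePt, imUnits_re hI]

theorem norm_slicePt_im {I : ℍ} (hI : I ∈ imUnits) (x y : ℝ) : ‖(slicePt I x y).im‖ = |y| := by
  rw [slicePt_im hI, norm_smul, norm_imUnits hI, mul_one, Real.norm_eq_abs]

theorem slicePt_mem_offReal {I : ℍ} (hI : I ∈ imUnits) {x y : ℝ} :
    slicePt I x y ∈ offReal ↔ y ≠ 0 := by
  show (slicePt I x y).im ≠ 0 ↔ y ≠ 0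
  rw [← norm_ne_zero_iff, norm_slicePt_im hI, abs_ne_zero]

theorem unitOf_slicePt {I : ℍ} (hI : I ∈ imUnits) {x y : ℝ} (hy : 0 < y) :
    unitOf (slicePt I x y) = I := by
  rw [unitOf, norm_slicePt_im hI, slicePt_im hI, smul_smul, abs_of_pos hy,
    inv_mul_cancel₀ hy.ne', one_smul]

theorem unitOf_mem {q : ℍ} (hq : q ∈ offReal) : unitOf q ∈ imUnits := by
  have h0 : ‖q.im‖ ≠ 0 := norm_ne_zero_iff.2 hq
  have h := norm_sq_eq q.im
  simp at h
  rw [mem_imUnits_iff]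
  refine ⟨by simp [unitOf], ?_⟩
  simp only [unitOf, Quaternion.imI_smul, Quaternion.imJ_smul, Quaternion.imK_smul,
    Quaternion.imI_im, Quaternion.imJ_im, Quaternion.imK_im, smul_eq_mul]
  field_simp
  linarith

theorem norm_sl {I : ℍ} (hI : I ∈ imUnits) (z : ℂ) : ‖sl I z‖ = ‖z‖ := by
  have h1 := norm_sq_eq (sl I z)
  have h2 := imUnits_sq hI
  have h3 : ‖z‖ ^ 2 = z.re ^ 2 + z.im ^ 2 := by
    rw [← Complex.normSq_eq_norm_sq, Complex.normSq_apply]; ring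
  have h4 : ‖sl I z‖ ^ 2 = ‖z‖ ^ 2 := by
    rw [h1, h3]
    simp only [sl, slicePt]
    simp [imUnits_re hI]
    linear_combination z.im ^ 2 * h2
  exact (sq_eq_sq₀ (norm_nonneg _) (norm_nonneg _)).1 h4

theorem sl_mul {I : ℍ} (hI : I ∈ imUnits) (z w : ℂ) : sl I (z * w) = sl I z * sl I w := by
  have h1 := imUnits_re hI
  have h2 := imUnits_sq hI
  ext <;> simp [sl, slicePt, h1]
  · linear_combination (z.im * w.im) * h2
  all_goals ring

theorem sl_one (I : ℍ) : sl I 1 = 1 := by simp [sl, slicePt]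

theorem sl_pow {I : ℍ} (hI : I ∈ imUnits) (z : ℂ) (n : ℕ) : sl I (z ^ n) = sl I z ^ n := by
  induction n with
  | zero => simp [sl_one]
  | succ n ih => rw [pow_succ, sl_mul hI, ih, pow_succ]

/-- The component `⟪q, p⟫ - i⟪I q, p⟫`, complex linear for left multiplication by `I`. -/
noncomputable def coord (I p : ℍ) : ℍ →L[ℝ] ℂ :=
  Complex.ofRealCLM.comp (innerSL ℝ p)
    - Complex.I • (Complex.ofRealCLM.comp ((innerSL ℝ p).comp (ContinuousLinearMap.mul ℝ ℍ I)))

theorem coord_apply (I p q : ℍ) :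
    coord I p q = (inner ℝ p q : ℝ) - Complex.I * (inner ℝ p (I * q) : ℝ) := by
  simp [coord]

theorem coord_re (I p q : ℍ) : (coord I p q).re = inner ℝ p q := by
  simp [coord_apply]

theorem coord_mul {I : ℍ} (hI : I ∈ imUnits) (p q : ℍ) :
    coord I p (I * q) = Complex.I * coord I p q := by
  have h : I * (I * q) = -q := by rw [← mul_assoc, show I * I = -1 from hI, neg_one_mul]
  rw [coord_apply, coord_apply, h, inner_neg_right]
  push_cast
  linear_combination (inner ℝ p (I * q) : ℂ) * Complex.I_sq

theorem coord_sl_mul {I : ℍ} (hI : I ∈ imUnits) (p q : ℍ) (z : ℂ) :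
    coord I p (sl I z * q) = z * coord I p q := by
  have h : sl I z * q = z.re • q + z.im • (I * q) := by
    rw [sl, slicePt, add_mul, Quaternion.coe_mul_eq_smul, smul_mul_assoc]
  rw [h, map_add, map_smul, map_smul, coord_mul hI]
  conv_rhs => rw [← Complex.re_add_im z]
  simp only [Complex.real_smul]
  ring

/-- The standard basis of the quaternions. -/
noncomputable def stdBasis : Fin 4 → ℍ := ![ofCoords 1 0 0 0, ofCoords 0 1 0 0, ofCoords 0 0 1 0, ofCoords 0 0 0 1]

@[simp] theorem ofCoords_re (a b c d : ℝ) : (ofCoords a b c d).re = a := rfl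
@[simp] theorem ofCoords_imI (a b c d : ℝ) : (ofCoords a b c d).imI = b := rfl
@[simp] theorem ofCoords_imJ (a b c d : ℝ) : (ofCoords a b c d).imJ = c := rfl
@[simp] theorem ofCoords_imK (a b c d : ℝ) : (ofCoords a b c d).imK = d := rfl

/-- The real parts of the four components are the ordinary real coordinates, so scalar results can
be reassembled into quaternionic ones. -/
theorem sum_coord_re_smul (I q : ℍ) : ∑ k, (coord I (stdBasis k) q).re • stdBasis k = q := by
  simp only [coord_re, Quaternion.inner_def, stdBasis, Fin.sum_univ_four]
  ext <;> simp [-Matrix.smul_cons]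

/-- Four components describe a space of complex dimension two: the real parts recover `‖q‖²` and the
imaginary parts recover `‖I q‖²`. -/
theorem sum_norm_coord_sq {I : ℍ} (hI : I ∈ imUnits) (q : ℍ) :
    ∑ k, ‖coord I (stdBasis k) q‖ ^ 2 = 2 * ‖q‖ ^ 2 := by
  have h : ∀ q : ℍ, ∑ k, (inner ℝ (stdBasis k) q : ℝ) ^ 2 = ‖q‖ ^ 2 := by
    intro q
    simp only [Quaternion.inner_def, stdBasis, Fin.sum_univ_four, norm_sq_eq]
    simp
  have h2 : ∀ k, ‖coord I (stdBasis k) q‖ ^ 2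
      = (inner ℝ (stdBasis k) q : ℝ) ^ 2 + (inner ℝ (stdBasis k) (I * q) : ℝ) ^ 2 := by
    intro k
    rw [← Complex.normSq_eq_norm_sq, Complex.normSq_apply, coord_apply]
    simp
    ring
  simp only [h2, Finset.sum_add_distrib, h, norm_mul, norm_imUnits hI]
  ring

theorem eq_of_coord {I q r : ℍ} (h : ∀ k, coord I (stdBasis k) q = coord I (stdBasis k) r) :
    q = r := by
  rw [← sum_coord_re_smul I q, ← sum_coord_re_smul I r]
  simp [h]

/-! ### Slice derivatives, Cauchy–Riemann equations and the operator `□` on one slice. -/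

theorem isOpen_offReal : IsOpen offReal :=
  isOpen_compl_singleton.preimage Quaternion.continuous_im

theorem isOpen_im_ne_zero : IsOpen {z : ℂ | z.im ≠ 0} :=
  isOpen_ne.preimage Complex.continuous_im

theorem sliceContDiff_iff {k : ℕ} {f : ℍ → ℍ} :
    SliceContDiff k f offReal ↔
      ∀ I ∈ imUnits, ContDiffOn ℝ k (fun z => f (sl I z)) {z : ℂ | z.im ≠ 0} := by
  refine forall₂_congr fun I hI => ?_
  have hset : {p : ℝ × ℝ | slicePt I p.1 p.2 ∈ offReal} = {p | p.2 ≠ 0} := by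
    ext p; exact slicePt_mem_offReal hI
  rw [hset]
  refine ⟨fun h => ?_, fun h => ?_⟩
  · exact h.comp (Complex.equivRealProdCLM.contDiff.contDiffOn) (fun z hz => hz)
  · exact h.comp (Complex.equivRealProdCLM.symm.contDiff.contDiffOn) (fun z hz => hz)

theorem hasDerivAt_slice_re {E : Type*} [NormedAddCommGroup E] [NormedSpace ℝ E] {u : ℂ → E}
    {z : ℂ} (hu : DifferentiableAt ℝ u z) :
    HasDerivAt (fun s : ℝ => u ⟨s, z.im⟩) (fderiv ℝ u z 1) z.re := by
  have h : HasDerivAt (fun s : ℝ => (⟨s, z.im⟩ : ℂ)) 1 z.re := by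
    have := (Complex.ofRealCLM.hasDerivAt (x := z.re)).add_const ((z.im : ℂ) * Complex.I)
    simp only [Complex.ofRealCLM_apply, Complex.ofReal_one] at this
    rwa [show (fun s : ℝ => (⟨s, z.im⟩ : ℂ)) = fun s : ℝ => (s : ℂ) + z.im * Complex.I from
      funext fun s => Complex.mk_eq_add_mul_I s z.im]
  exact (show HasFDerivAt u _ _ from hu.hasFDerivAt).comp_hasDerivAt z.re h

theorem hasDerivAt_slice_im {E : Type*} [NormedAddCommGroup E] [NormedSpace ℝ E] {u : ℂ → E}
    {z : ℂ} (hu : DifferentiableAt ℝ u z) :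
    HasDerivAt (fun t : ℝ => u ⟨z.re, t⟩) (fderiv ℝ u z Complex.I) z.im := by
  have h : HasDerivAt (fun s : ℝ => (⟨z.re, s⟩ : ℂ)) Complex.I z.im := by
    have := ((Complex.ofRealCLM.hasDerivAt (x := z.im)).mul_const Complex.I).const_add (z.re : ℂ)
    simp only [Complex.ofRealCLM_apply, Complex.ofReal_one, one_mul] at this
    rwa [show (fun s : ℝ => (⟨z.re, s⟩ : ℂ)) = fun s : ℝ => (z.re : ℂ) + s * Complex.I from
      funext fun s => Complex.mk_eq_add_mul_I z.re s]
  exact (show HasFDerivAt u _ _ from hu.hasFDerivAt).comp_hasDerivAt z.im h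

theorem partialX_eq {f : ℍ → ℍ} {I : ℍ} {z : ℂ}
    (hu : DifferentiableAt ℝ (fun z => f (sl I z)) z) :
    partialX f I z.re z.im = fderiv ℝ (fun z => f (sl I z)) z 1 :=
  (hasDerivAt_slice_re hu).deriv

theorem partialY_eq {f : ℍ → ℍ} {I : ℍ} {z : ℂ}
    (hu : DifferentiableAt ℝ (fun z => f (sl I z)) z) :
    partialY f I z.re z.im = fderiv ℝ (fun z => f (sl I z)) z Complex.I :=
  (hasDerivAt_slice_im hu).deriv

theorem deriv_deriv_slice_re {E : Type*} [NormedAddCommGroup E] [NormedSpace ℝ E] {u : ℂ → E}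
    {z : ℂ} (hu : ContDiffAt ℝ 2 u z) :
    deriv (deriv fun s : ℝ => u ⟨s, z.im⟩) z.re = fderiv ℝ (fderiv ℝ u) z 1 1 := by
  have h1 : ∀ᶠ w in 𝓝 z, DifferentiableAt ℝ u w :=
    (hu.eventually (by simp)).mono fun w hw => hw.differentiableAt (by simp)
  have h2 : Tendsto (fun s : ℝ => (⟨s, z.im⟩ : ℂ)) (𝓝 z.re) (𝓝 z) := by
    have : Continuous fun s : ℝ => (⟨s, z.im⟩ : ℂ) :=
      Complex.equivRealProdCLM.symm.continuous.comp (continuous_id.prodMk continuous_const)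
    exact this.tendsto z.re
  have h3 : deriv (fun s : ℝ => u ⟨s, z.im⟩) =ᶠ[𝓝 z.re] fun s => fderiv ℝ u ⟨s, z.im⟩ 1 := by
    filter_upwards [h2.eventually h1] with s hs
    exact (hasDerivAt_slice_re hs).deriv
  rw [h3.deriv_eq]
  have h4 : DifferentiableAt ℝ (fderiv ℝ u) z :=
    (hu.fderiv_right (m := 1) (by norm_num)).differentiableAt (by simp)
  exact ((ContinuousLinearMap.apply ℝ E (1 : ℂ)).hasFDerivAt.comp_hasDerivAt z.re
    (hasDerivAt_slice_re h4)).deriv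

theorem deriv_deriv_slice_im {E : Type*} [NormedAddCommGroup E] [NormedSpace ℝ E] {u : ℂ → E}
    {z : ℂ} (hu : ContDiffAt ℝ 2 u z) :
    deriv (deriv fun t : ℝ => u ⟨z.re, t⟩) z.im
      = fderiv ℝ (fderiv ℝ u) z Complex.I Complex.I := by
  have h1 : ∀ᶠ w in 𝓝 z, DifferentiableAt ℝ u w :=
    (hu.eventually (by simp)).mono fun w hw => hw.differentiableAt (by simp)
  have h2 : Tendsto (fun s : ℝ => (⟨z.re, s⟩ : ℂ)) (𝓝 z.im) (𝓝 z) := by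
    have : Continuous fun s : ℝ => (⟨z.re, s⟩ : ℂ) :=
      Complex.equivRealProdCLM.symm.continuous.comp (continuous_const.prodMk continuous_id)
    exact this.tendsto z.im
  have h3 : deriv (fun t : ℝ => u ⟨z.re, t⟩) =ᶠ[𝓝 z.im]
      fun t => fderiv ℝ u ⟨z.re, t⟩ Complex.I := by
    filter_upwards [h2.eventually h1] with s hs
    exact (hasDerivAt_slice_im hs).deriv
  rw [h3.deriv_eq]
  have h4 : DifferentiableAt ℝ (fderiv ℝ u) z :=
    (hu.fderiv_right (m := 1) (by norm_num)).differentiableAt (by simp)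
  exact ((ContinuousLinearMap.apply ℝ E Complex.I).hasFDerivAt.comp_hasDerivAt z.im
    (hasDerivAt_slice_im h4)).deriv

theorem partialXX_eq {f : ℍ → ℍ} {I : ℍ} {z : ℂ}
    (hu : ContDiffAt ℝ 2 (fun z => f (sl I z)) z) :
    partialXX f I z.re z.im = fderiv ℝ (fderiv ℝ (fun z => f (sl I z))) z 1 1 := by
  rw [partialXX, iteratedDeriv_succ, iteratedDeriv_one]
  exact deriv_deriv_slice_re hu

theorem partialYY_eq {f : ℍ → ℍ} {I : ℍ} {z : ℂ}
    (hu : ContDiffAt ℝ 2 (fun z => f (sl I z)) z) :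
    partialYY f I z.re z.im = fderiv ℝ (fderiv ℝ (fun z => f (sl I z))) z Complex.I Complex.I := by
  rw [partialYY, iteratedDeriv_succ, iteratedDeriv_one]
  exact deriv_deriv_slice_im hu

/-- Cauchy–Riemann equations for the components of a function with values in `(ℍ, I)`. -/
theorem differentiableAt_coord_iff {I : ℍ} (hI : I ∈ imUnits) {u : ℂ → ℍ} {z : ℂ}
    (hu : DifferentiableAt ℝ u z) :
    (∀ k, DifferentiableAt ℂ (fun w => coord I (stdBasis k) (u w)) z) ↔
      fderiv ℝ u z Complex.I = I * fderiv ℝ u z 1 := by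
  have h : ∀ k, HasFDerivAt (fun w => coord I (stdBasis k) (u w))
      ((coord I (stdBasis k)).comp (fderiv ℝ u z)) z :=
    fun k => (coord I (stdBasis k)).hasFDerivAt.comp z hu.hasFDerivAt
  have h2 : ∀ k, DifferentiableAt ℂ (fun w => coord I (stdBasis k) (u w)) z ↔
      coord I (stdBasis k) (fderiv ℝ u z Complex.I)
        = coord I (stdBasis k) (I * fderiv ℝ u z 1) := by
    intro k
    rw [differentiableAt_complex_iff_differentiableAt_real, (h k).fderiv, coord_mul hI]
    exact ⟨fun H => H.2, fun H => ⟨(h k).differentiableAt, H⟩⟩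
  simp only [h2]
  exact ⟨eq_of_coord, fun H k => by rw [H]⟩

theorem regular_iff_cauchyRiemann {I : ℍ} (hI : I ∈ imUnits) (a b : ℍ) :
    (1 / 2 : ℝ) • (a + I * b) = 0 ↔ b = I * a := by
  have h : I * I = -1 := hI
  rw [smul_eq_zero_iff_right (by norm_num)]
  constructor
  · intro H
    have : I * (a + I * b) = 0 := by rw [H, mul_zero]
    rw [mul_add, ← mul_assoc, h, neg_one_mul] at this
    exact (eq_of_sub_eq_zero (by rw [sub_eq_add_neg]; exact this)).symm
  · rintro rfl
    rw [← mul_assoc, h, neg_one_mul, add_neg_cancel]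

/-- Holomorphic components are smooth, which bridges the `C¹` requirement for regularity and the
`C²` requirement for `□`. -/
theorem contDiffOn_of_coord {I : ℍ} {u : ℂ → ℍ} {s : Set ℂ} (hs : IsOpen s) {n : ℕ}
    (h : ∀ k, DifferentiableOn ℂ (fun w => coord I (stdBasis k) (u w)) s) :
    ContDiffOn ℝ n u s := by
  have h2 : ∀ k, ContDiffOn ℝ n (fun w => coord I (stdBasis k) (u w)) s :=
    fun k => ((h k).contDiffOn hs).restrict_scalars ℝ
  have h3 : u = fun w => ∑ k, (coord I (stdBasis k) (u w)).re • stdBasis k := by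
    ext1 w; rw [sum_coord_re_smul]
  rw [h3]
  refine ContDiffOn.sum fun k _ => ?_
  exact (Complex.reCLM.contDiff.comp_contDiffOn (h2 k)).smul contDiffOn_const

/-- A slice regular function on the slice `ℂ_I` is annihilated by `□`. -/
theorem boxAt_eq_zero_of_holomorphic {f : ℍ → ℍ} {I : ℍ} (hI : I ∈ imUnits)
    (h : ∀ k, DifferentiableOn ℂ (fun w => coord I (stdBasis k) (f (sl I w))) {z | z.im ≠ 0})
    {z : ℂ} (hz : z.im ≠ 0) : boxAt f I z.re z.im = 0 := by
  set u : ℂ → ℍ := fun w => f (sl I w) with hu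
  have hII : I * I = -1 := hI
  have hcd : ContDiffOn ℝ 2 u {z | z.im ≠ 0} :=
    contDiffOn_of_coord (n := 2) isOpen_im_ne_zero h
  have hcda : ∀ w : ℂ, w.im ≠ 0 → ContDiffAt ℝ 2 u w :=
    fun w hw => hcd.contDiffAt (isOpen_im_ne_zero.mem_nhds hw)
  have hcr : ∀ w : ℂ, w.im ≠ 0 → fderiv ℝ u w Complex.I = I * fderiv ℝ u w 1 := fun w hw =>
    (differentiableAt_coord_iff hI ((hcda w hw).differentiableAt (by simp))).1 fun k =>
      (h k).differentiableAt (isOpen_im_ne_zero.mem_nhds hw)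
  have hd2 : DifferentiableAt ℝ (fderiv ℝ u) z :=
    ((hcda z hz).fderiv_right (m := 1) (by norm_num)).differentiableAt (by simp)
  have hD : ∀ v, fderiv ℝ (fderiv ℝ u) z v Complex.I = I * fderiv ℝ (fderiv ℝ u) z v 1 := by
    intro v
    have e1 := (hd2.hasFDerivAt.clm_apply (hasFDerivAt_const Complex.I z))
    have e2 := (hd2.hasFDerivAt.clm_apply (hasFDerivAt_const (1 : ℂ) z)).const_mul I
    have e3 : (fun w => fderiv ℝ u w Complex.I) =ᶠ[𝓝 z] fun w => I * fderiv ℝ u w 1 := by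
      filter_upwards [isOpen_im_ne_zero.mem_nhds hz] with w hw using hcr w hw
    have e4 := (e2.congr_of_eventuallyEq e3).unique e1
    have := congrArg (fun L => L v) e4
    simpa using this.symm
  have hsymm : fderiv ℝ (fderiv ℝ u) z 1 Complex.I = fderiv ℝ (fderiv ℝ u) z Complex.I 1 :=
    ((hcda z hz).isSymmSndFDerivAt (by simp)).eq 1 Complex.I
  have hdu := (hcda z hz).differentiableAt (by simp)
  rw [boxAt, partialXX_eq (hcda z hz), partialYY_eq (hcda z hz), partialX_eq hdu, partialY_eq hdu,
    hcr z hz]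
  -- Differentiating `u_y = I u_x` and using symmetry of the second derivative makes `u` harmonic;
  -- the first-order terms then cancel by the same relation.
  have e1 : fderiv ℝ (fderiv ℝ u) z Complex.I Complex.I = -fderiv ℝ (fderiv ℝ u) z 1 1 := by
    rw [hD, ← hsymm, hD, ← mul_assoc, hII, neg_one_mul]
  rw [e1, add_neg_cancel, smul_zero, neg_zero, zero_add, mul_sub, mul_smul_comm, ← mul_assoc, hII,
    neg_one_mul, mul_smul_comm]
  rw [show fderiv ℝ (fun z => f (sl I z)) z = fderiv ℝ u z from rfl]
  module

/-- On each slice, the square integrable solutions of `□f = 0` are regular. -/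
theorem cauchyRiemann_of_boxAt_eq_zero {f : ℍ → ℍ} {I : ℍ} (hI : I ∈ imUnits)
    (hcd : ContDiffOn ℝ 2 (fun z => f (sl I z)) {z | z.im ≠ 0})
    (hbox : ∀ x y : ℝ, 0 < y → boxAt f I x y = 0)
    (hfin : ∫⁻ z in {z : ℂ | 1 < z.im},
      ‖f (sl I z)‖ₑ ^ 2 * ENNReal.ofReal (Real.exp (-‖z‖ ^ 2)) < ⊤) (k : Fin 4) :
    DifferentiableOn ℂ (fun w => coord I (stdBasis k) (f (sl I w))) {z | 0 < z.im} := by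
  set u : ℂ → ℍ := fun w => f (sl I w) with hu
  set c := coord I (stdBasis k) with hc
  have hcda : ∀ w : ℂ, 0 < w.im → ContDiffAt ℝ 2 u w :=
    fun w hw => hcd.contDiffAt (isOpen_im_ne_zero.mem_nhds hw.ne')
  have hdu : ∀ w : ℂ, 0 < w.im → DifferentiableAt ℝ u w :=
    fun w hw => (hcda w hw).differentiableAt (by simp)
  have hφ : ∀ z : ℂ, 0 < z.im → HasFDerivAt (fun w => c (u w)) (c.comp (fderiv ℝ u z)) z :=
    fun z hz => c.hasFDerivAt.comp z (hdu z hz).hasFDerivAt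
  have hd2 : ∀ z : ℂ, 0 < z.im → HasFDerivAt (fderiv ℝ u) (fderiv ℝ (fderiv ℝ u) z) z :=
    fun z hz => (((hcda z hz).fderiv_right (m := 1) (by norm_num)).differentiableAt
      (by simp)).hasFDerivAt
  have hg := fun (v : ℂ) (z : ℂ) (hz : 0 < z.im) =>
    c.hasFDerivAt.comp z ((hd2 z hz).clm_apply (hasFDerivAt_const v z))
  have hmain := dbar_eq_zero_of_lintegral_lt_top (φ := fun w => c (u w))
    (g := fun w => c (fderiv ℝ u w 1) + Complex.I * c (fderiv ℝ u w Complex.I)) hφ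
    (fun z hz => (hg 1 z hz).add ((hg Complex.I z hz).const_mul Complex.I)) ?_ ?_ ?_
  · intro z hz
    apply DifferentiableAt.differentiableWithinAt
    rw [differentiableAt_complex_iff_differentiableAt_real, (hφ z hz).fderiv]
    refine ⟨(hφ z hz).differentiableAt, ?_⟩
    have := hmain z hz
    simp only [ContinuousLinearMap.comp_apply, smul_eq_mul]
    linear_combination (-Complex.I) * this + c (fderiv ℝ u z Complex.I) * Complex.I_sq
  · intro z hz
    rfl
  · intro z hz
    have hb := hbox z.re z.im hz
    rw [boxAt, partialXX_eq (hcda z hz), partialYY_eq (hcda z hz), partialX_eq (hdu z hz),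
      partialY_eq (hdu z hz)] at hb
    have hb2 := congrArg c hb
    have hsymm : fderiv ℝ (fderiv ℝ u) z 1 Complex.I = fderiv ℝ (fderiv ℝ u) z Complex.I 1 :=
      ((hcda z hz).isSymmSndFDerivAt (by simp)).eq 1 Complex.I
    simp only [map_add, map_neg, map_smul, coord_mul hI, hc, map_sub, map_zero,
      Complex.real_smul] at hb2
    have hz2 : (starRingEnd ℂ) z = z.re - z.im * Complex.I := by
      apply Complex.ext <;> simp
    simp only [hz2, add_apply, smul_apply, ContinuousLinearMap.comp_apply, smul_eq_mul,
      ContinuousLinearMap.flip_apply, ContinuousLinearMap.comp_zero, zero_add, hsymm]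
    push_cast at hb2
    rw [show (fun z => f (sl I z)) = u from rfl, ← hc] at hb2
    -- With `g = 2∂̄φ`, the expression `g_x - i g_y - 2 z̄ g` is `-4` times the component of `□f`.
    linear_combination (-4) * hb2 + (-c (fderiv ℝ (fderiv ℝ u) z Complex.I Complex.I)
      + 2 * z.im * c (fderiv ℝ u z Complex.I)) * Complex.I_sq
  · obtain ⟨K, hK⟩ : ∃ K : ℝ, ∀ q, ‖c q‖ ≤ K * ‖q‖ := ⟨‖c‖, c.le_opNorm⟩
    have hle : ∀ z : ℂ, ‖c (u z)‖ₑ ^ 2 * ENNReal.ofReal (Real.exp (-‖z‖ ^ 2)) ≤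
        ENNReal.ofReal K ^ 2 * (‖u z‖ₑ ^ 2 * ENNReal.ofReal (Real.exp (-‖z‖ ^ 2))) := by
      intro z
      rw [← mul_assoc, ← mul_pow]
      gcongr
      rw [← ofReal_norm, ← ofReal_norm, ← ENNReal.ofReal_mul' (norm_nonneg _)]
      exact ENNReal.ofReal_le_ofReal (hK _)
    refine (lintegral_mono hle).trans_lt ?_
    rw [lintegral_const_mul' _ _ (by finiteness)]
    exact ENNReal.mul_lt_top (by finiteness) hfin

/-! ### Disintegration of the two measures over the sphere of imaginary units. -/

/-- `|f|² e^{-|q|²}` on `ℍ ∖ ℝ`, extended by zero. -/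
noncomputable def gaussDensity (f : ℍ → ℍ) : ℍ → ℝ≥0∞ :=
  offReal.indicator fun q => ‖f q‖ₑ ^ 2 * ENNReal.ofReal (Real.exp (-‖q‖ ^ 2))

/-- Nothing is known about `f` on the real axis, so global measurability requires cutting it off
there. -/
theorem measurable_indicator_offReal {f : ℍ → ℍ} (hf : ContinuousOn f offReal) :
    Measurable (offReal.indicator f) := by
  classical
  rw [← Set.piecewise_eq_indicator]
  exact hf.measurable_piecewise continuousOn_const isOpen_offReal.measurableSet

theorem gaussDensity_eq (f : ℍ → ℍ) (q : ℍ) : gaussDensity f q =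
    ‖offReal.indicator f q‖ₑ ^ 2 * ENNReal.ofReal (Real.exp (-‖q‖ ^ 2)) := by
  by_cases hq : q ∈ offReal
  · simp [gaussDensity, hq]
  · simp [gaussDensity, hq]

theorem measurable_gaussDensity {f : ℍ → ℍ} (hf : ContinuousOn f offReal) :
    Measurable (gaussDensity f) := by
  have h : gaussDensity f = fun q =>
      ‖offReal.indicator f q‖ₑ ^ 2 * ENNReal.ofReal (Real.exp (-‖q‖ ^ 2)) :=
    funext (gaussDensity_eq f)
  rw [h]
  have := measurable_indicator_offReal hf
  fun_prop

theorem mem_gaussL2_iff {f : ℍ → ℍ} (hf : ContinuousOn f offReal) (ν : Measure ℍ) :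
    f ∈ gaussL2 ν ↔ ∫⁻ q, gaussDensity f q ∂ν < ⊤ := by
  have hρ : Measurable fun q : ℍ => ENNReal.ofReal (Real.exp (-‖q‖ ^ 2)) := by fun_prop
  have hm : AEStronglyMeasurable f
      ((ν.restrict offReal).withDensity (fun q => ENNReal.ofReal (Real.exp (-‖q‖ ^ 2)))) :=
    (hf.aestronglyMeasurable isOpen_offReal.measurableSet).mono_ac
      (withDensity_absolutelyContinuous _ _)
  have h1 : ∫⁻ q, gaussDensity f q ∂ν = ∫⁻ q, ‖f q‖ₑ ^ (2 : ℝ≥0∞).toReal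
      ∂((ν.restrict offReal).withDensity (fun q => ENNReal.ofReal (Real.exp (-‖q‖ ^ 2)))) := by
    rw [lintegral_withDensity_eq_lintegral_mul_non_measurable _ hρ (by simp), gaussDensity,
      lintegral_indicator isOpen_offReal.measurableSet]
    refine lintegral_congr fun q => ?_
    simp [mul_comm]
  rw [h1, ← eLpNorm_lt_top_iff_lintegral_rpow_enorm_lt_top (by simp) (by simp)]
  exact ⟨fun h => h.2, fun h => ⟨hm, h⟩⟩

theorem gaussDensity_sl {f : ℍ → ℍ} {I : ℍ} (hI : I ∈ imUnits) {z : ℂ} (hz : z.im ≠ 0) :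
    gaussDensity f (sl I z) = ‖f (sl I z)‖ₑ ^ 2 * ENNReal.ofReal (Real.exp (-‖z‖ ^ 2)) := by
  have h : sl I z ∈ offReal := (slicePt_mem_offReal hI).2 hz
  rw [gaussDensity, Set.indicator_of_mem h, norm_sl hI]

/-- The embedding of the unit sphere of `ℝ³` as the sphere of imaginary units. -/
noncomputable def sphereUnit (w : Metric.sphere (0 : EuclideanSpace ℝ (Fin 3)) 1) : ℍ :=
  ofCoords 0 (w.1 0) (w.1 1) (w.1 2)

theorem continuous_ofCoords :
    Continuous fun p : ℝ × ℝ × ℝ × ℝ => ofCoords p.1 p.2.1 p.2.2.1 p.2.2.2 := by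
  have h : (fun p : ℝ × ℝ × ℝ × ℝ => ofCoords p.1 p.2.1 p.2.2.1 p.2.2.2) = fun p =>
      p.1 • ofCoords 1 0 0 0 + p.2.1 • ofCoords 0 1 0 0 + p.2.2.1 • ofCoords 0 0 1 0
        + p.2.2.2 • ofCoords 0 0 0 1 := by
    ext p <;> simp
  rw [h]
  fun_prop

theorem continuous_sphereUnit : Continuous sphereUnit := by
  have h : Continuous fun w : Metric.sphere (0 : EuclideanSpace ℝ (Fin 3)) 1 =>
      ((0 : ℝ), w.1 0, w.1 1, w.1 2) := by fun_prop
  exact continuous_ofCoords.comp h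

theorem sphereUnit_mem (w : Metric.sphere (0 : EuclideanSpace ℝ (Fin 3)) 1) :
    sphereUnit w ∈ imUnits := by
  have h : ‖w.1‖ = 1 := by simp
  have h2 : ‖w.1‖ ^ 2 = 1 := by rw [h]; norm_num
  rw [EuclideanSpace.norm_sq_eq, Fin.sum_univ_three] at h2
  rw [mem_imUnits_iff]
  refine ⟨rfl, ?_⟩
  simp only [Real.norm_eq_abs, sq_abs] at h2
  exact h2

theorem exists_sphereUnit_eq {I : ℍ} (hI : I ∈ imUnits) : ∃ w, sphereUnit w = I := by
  refine ⟨⟨!₂[I.imI, I.imJ, I.imK], ?_⟩, ?_⟩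
  · rw [mem_sphere_zero_iff_norm, EuclideanSpace.norm_eq, Fin.sum_univ_three]
    simp [imUnits_sq hI]
  · ext <;> simp [sphereUnit, imUnits_re hI]

theorem sphereArea_eq : sphereArea =
    Measure.map sphereUnit (volume : Measure (EuclideanSpace ℝ (Fin 3))).toSphere := rfl

instance : IsFiniteMeasure sphereArea := by
  rw [sphereArea_eq]; infer_instance

theorem ae_mem_imUnits : ∀ᵐ I ∂sphereArea, I ∈ imUnits := by
  have hm : MeasurableSet imUnits := by
    have : IsClosed imUnits := isClosed_eq (by fun_prop) continuous_const
    exact this.measurableSet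
  rw [sphereArea_eq]
  exact (ae_map_iff continuous_sphereUnit.aemeasurable hm).2 (Eventually.of_forall sphereUnit_mem)

/-- The area measure charges every nonempty open subset of the sphere, so a set of full measure is
dense. -/
theorem mem_closure_of_ae {P : ℍ → Prop}
    (h : ∀ᵐ w ∂(volume : Measure (EuclideanSpace ℝ (Fin 3))).toSphere, P (sphereUnit w))
    {I : ℍ} (hI : I ∈ imUnits) : I ∈ closure {J | J ∈ imUnits ∧ P J} := by
  obtain ⟨w, rfl⟩ := exists_sphereUnit_eq hI
  have hd := Measure.dense_of_ae h
  refine map_mem_closure continuous_sphereUnit (hd w) ?_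
  exact fun w hw => ⟨sphereUnit_mem w, hw⟩

theorem lintegral_polarMeasure {G : ℍ → ℝ≥0∞} (hG : Measurable G) :
    ∫⁻ q, G q ∂polarMeasure = ∫⁻ I, (∫⁻ r in Set.Ioi (0 : ℝ), ENNReal.ofReal r *
      ∫⁻ θ in Set.Ioo (0 : ℝ) (2 * Real.pi),
        G (slicePt I (r * Real.cos θ) (r * Real.sin θ))) ∂sphereArea := by
  have hm : Measurable fun p : ℝ × ℝ × ℍ =>
      slicePt p.2.2 (p.1 * Real.cos p.2.1) (p.1 * Real.sin p.2.1) := by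
    have hc : Continuous fun p : ℝ × ℝ × ℍ =>
      slicePt p.2.2 (p.1 * Real.cos p.2.1) (p.1 * Real.sin p.2.1) :=
      continuous_slicePt.comp (f := fun p : ℝ × ℝ × ℍ =>
        (p.1 * Real.cos p.2.1, p.1 * Real.sin p.2.1, p.2.2)) (by fun_prop)
    exact hc.measurable
  have hGm : Measurable fun p : ℝ × ℝ × ℍ =>
      G (slicePt p.2.2 (p.1 * Real.cos p.2.1) (p.1 * Real.sin p.2.1)) := hG.comp hm
  rw [polarMeasure, lintegral_map hG hm, lintegral_prod _ hGm.aemeasurable]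
  have h1 : ∀ r : ℝ, ∫⁻ p : ℝ × ℍ, G (slicePt p.2 (r * Real.cos p.1) (r * Real.sin p.1))
      ∂((volume.restrict (Set.Ioo (0 : ℝ) (2 * Real.pi))).prod sphereArea)
      = ∫⁻ I, (∫⁻ θ in Set.Ioo (0 : ℝ) (2 * Real.pi),
        G (slicePt I (r * Real.cos θ) (r * Real.sin θ))) ∂sphereArea := by
    intro r
    exact lintegral_prod_symm _ (hGm.comp (measurable_prodMk_left (x := r))).aemeasurable
  have h2 : Measurable fun p : ℝ × ℍ => ∫⁻ θ in Set.Ioo (0 : ℝ) (2 * Real.pi),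
      G (slicePt p.2 (p.1 * Real.cos θ) (p.1 * Real.sin θ)) := by
    refine Measurable.lintegral_prod_right' (f := fun q : (ℝ × ℍ) × ℝ =>
      G (slicePt q.1.2 (q.1.1 * Real.cos q.2) (q.1.1 * Real.sin q.2))) ?_
    exact hGm.comp (f := fun q : (ℝ × ℍ) × ℝ => (q.1.1, q.2, q.1.2)) (by fun_prop)
  simp only [h1]
  rw [lintegral_withDensity_eq_lintegral_mul _ ENNReal.measurable_ofReal
    (Measurable.lintegral_prod_right h2)]
  have h3 : ∀ r : ℝ, ((fun r => ENNReal.ofReal r) * fun r : ℝ =>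
      ∫⁻ I, (∫⁻ θ in Set.Ioo (0 : ℝ) (2 * Real.pi),
        G (slicePt I (r * Real.cos θ) (r * Real.sin θ))) ∂sphereArea) r =
      ∫⁻ I, (ENNReal.ofReal r * ∫⁻ θ in Set.Ioo (0 : ℝ) (2 * Real.pi),
        G (slicePt I (r * Real.cos θ) (r * Real.sin θ))) ∂sphereArea := by
    intro r
    rw [lintegral_const_mul' _ _ ENNReal.ofReal_ne_top, Pi.mul_apply]
  simp only [h3]
  exact lintegral_lintegral_swap
    ((ENNReal.measurable_ofReal.comp measurable_fst).mul h2).aemeasurable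

theorem lintegral_ofCoords_euclidean (x : ℝ) {G : ℍ → ℝ≥0∞} (hG : Measurable G) :
    ∫⁻ p : ℝ × ℝ × ℝ, G (ofCoords x p.1 p.2.1 p.2.2)
      = ∫⁻ v : EuclideanSpace ℝ (Fin 3), G (ofCoords x (v 0) (v 1) (v 2)) := by
  have e1 := EuclideanSpace.volume_preserving_symm_measurableEquiv_toLp (Fin 3)
  have e2 := volume_preserving_piFinSuccAbove (fun _ : Fin 3 => ℝ) 0
  have e3 := (MeasurePreserving.id (volume : Measure ℝ)).prod (volume_preserving_finTwoArrow ℝ)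
  have e := (e3.comp e2).comp e1
  have hm : Measurable fun p : ℝ × ℝ × ℝ => G (ofCoords x p.1 p.2.1 p.2.2) :=
    hG.comp (continuous_ofCoords.measurable.comp (f := fun p : ℝ × ℝ × ℝ => (x, p)) (by fun_prop))
  rw [Measure.volume_eq_prod, ← e.map_eq, lintegral_map hm e.measurable]
  rfl

/-- Polar coordinates in the three imaginary directions, where the factor `y²` is the radial
Jacobian in dimension three; the real direction is left untouched. -/
theorem lintegral_lebesgue {G : ℍ → ℝ≥0∞} (hG : Measurable G) :
    ∫⁻ q, G q ∂lebesgue = ∫⁻ w, (∫⁻ y in Set.Ioi (0 : ℝ), ENNReal.ofReal (y ^ 2) *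
      ∫⁻ x : ℝ, G (slicePt (sphereUnit w) x y))
        ∂(volume : Measure (EuclideanSpace ℝ (Fin 3))).toSphere := by
  have hc := continuous_ofCoords.measurable
  have hGc : Measurable fun p : ℝ × ℝ × ℝ × ℝ => G (ofCoords p.1 p.2.1 p.2.2.1 p.2.2.2) :=
    hG.comp hc
  rw [lebesgue, lintegral_map hG hc, Measure.volume_eq_prod, lintegral_prod _ hGc.aemeasurable]
  simp only [lintegral_ofCoords_euclidean _ hG]
  have hj : Measurable fun p : ℝ × EuclideanSpace ℝ (Fin 3) =>
      G (ofCoords p.1 (p.2 0) (p.2 1) (p.2 2)) :=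
    hGc.comp (f := fun p : ℝ × EuclideanSpace ℝ (Fin 3) => (p.1, p.2 0, p.2 1, p.2 2))
      (by fun_prop)
  rw [lintegral_lintegral_swap hj.aemeasurable]
  set g : EuclideanSpace ℝ (Fin 3) → ℝ≥0∞ := fun v =>
    ∫⁻ x : ℝ, G (ofCoords x (v 0) (v 1) (v 2)) with hg
  have hgm : Measurable g := by
    exact Measurable.lintegral_prod_left' hj
  have hpol : ∫⁻ v, g v = ∫⁻ p : Metric.sphere (0 : EuclideanSpace ℝ (Fin 3)) 1 × Set.Ioi (0 : ℝ),
      g (p.2.1 • p.1.1) ∂((volume : Measure (EuclideanSpace ℝ (Fin 3))).toSphere.prod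
        (Measure.volumeIoiPow 2)) := by
    have hmp := (volume : Measure (EuclideanSpace ℝ (Fin 3))).measurePreserving_homeomorphUnitSphereProd
    rw [show Module.finrank ℝ (EuclideanSpace ℝ (Fin 3)) - 1 = 2 by simp] at hmp
    have h0 : ∫⁻ v, g v = ∫⁻ v in ({0}ᶜ : Set (EuclideanSpace ℝ (Fin 3))), g v := by
      rw [restrict_compl_singleton]
    rw [h0, ← lintegral_subtype_comap (measurableSet_singleton _).compl, ← hmp.map_eq,
      lintegral_map (by fun_prop) hmp.measurable]
    refine lintegral_congr fun v => ?_
    congr 1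
    exact (congrArg Subtype.val ((homeomorphUnitSphereProd _).symm_apply_apply v)).symm
  rw [hpol, lintegral_prod _ (by fun_prop)]
  refine lintegral_congr fun w => ?_
  rw [Measure.volumeIoiPow, lintegral_withDensity_eq_lintegral_mul _ (by fun_prop) (by fun_prop)]
  have := lintegral_subtype_comap (μ := volume) (measurableSet_Ioi (a := (0 : ℝ)))
    (fun y : ℝ => ENNReal.ofReal (y ^ 2) * g (y • w.1))
  refine Eq.trans this (lintegral_congr fun y => ?_)
  congr 1
  refine lintegral_congr fun x => ?_
  congr 1
  ext <;> simp [slicePt, sphereUnit]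

/-- Only the upper half plane matters, that is `sin θ > 0`; there the angle windows `(-π, π)` and
`(0, 2π)` agree. -/
theorem setLIntegral_halfPlane_le_polar {g : ℂ → ℝ≥0∞} (hg : Measurable g) :
    ∫⁻ z in {z : ℂ | 1 < z.im}, g z ≤ ∫⁻ r in Set.Ioi (0 : ℝ), ENNReal.ofReal r *
      ∫⁻ θ in Set.Ioo (0 : ℝ) (2 * Real.pi), g ⟨r * Real.cos θ, r * Real.sin θ⟩ := by
  have hS : MeasurableSet {z : ℂ | 0 < z.im} :=
    (isOpen_lt continuous_const Complex.continuous_im).measurableSet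
  have hsub : {z : ℂ | 1 < z.im} ⊆ {z : ℂ | 0 < z.im} := fun z hz =>
    lt_trans one_pos (show 1 < z.im from hz)
  have hsymm : ∀ p : ℝ × ℝ, Complex.polarCoord.symm p
      = ⟨p.1 * Real.cos p.2, p.1 * Real.sin p.2⟩ := by
    intro p
    rw [Complex.polarCoord_symm_apply]
    apply Complex.ext <;> simp [Complex.cos_ofReal_re, Complex.sin_ofReal_re, Complex.cos_ofReal_im,
      Complex.sin_ofReal_im]
  have hpm : Measurable fun p : ℝ × ℝ => (⟨p.1 * Real.cos p.2, p.1 * Real.sin p.2⟩ : ℂ) :=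
    Complex.measurableEquivRealProd.symm.measurable.comp
      (f := fun p : ℝ × ℝ => (p.1 * Real.cos p.2, p.1 * Real.sin p.2)) (by fun_prop)
  refine (lintegral_mono_set hsub).trans ?_
  rw [← lintegral_indicator hS, ← Complex.lintegral_comp_polarCoord_symm, polarCoord_target,
    Measure.volume_eq_prod, ← Measure.prod_restrict]
  simp only [hsymm, smul_eq_mul]
  have hjm : Measurable fun p : ℝ × ℝ => ENNReal.ofReal p.1 *
      ({z : ℂ | 0 < z.im}).indicator g ⟨p.1 * Real.cos p.2, p.1 * Real.sin p.2⟩ :=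
    (ENNReal.measurable_ofReal.comp measurable_fst).mul ((hg.indicator hS).comp hpm)
  rw [lintegral_prod _ hjm.aemeasurable]
  refine setLIntegral_mono' measurableSet_Ioi fun r hr => ?_
  rw [lintegral_const_mul' _ _ ENNReal.ofReal_ne_top]
  refine mul_le_mul' le_rfl ?_
  rw [← lintegral_indicator measurableSet_Ioo, ← lintegral_indicator measurableSet_Ioo]
  refine lintegral_mono fun θ => ?_
  by_cases h1 : θ ∈ Set.Ioo (-Real.pi) Real.pi
  · rw [Set.indicator_of_mem h1]
    by_cases h2 : 0 < θ
    · rw [Set.indicator_of_mem (show θ ∈ Set.Ioo 0 (2 * Real.pi) from ⟨h2, by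
        linarith [h1.2, Real.pi_pos]⟩)]
      exact Set.indicator_le_self _ _ _
    · rw [Set.indicator_of_notMem]
      · exact zero_le
      · show ¬ (0 < r * Real.sin θ)
        rw [not_lt]
        exact mul_nonpos_of_nonneg_of_nonpos (le_of_lt hr)
          (Real.sin_nonpos_of_nonpos_of_neg_pi_le (not_lt.1 h2) h1.1.le)
  · rw [Set.indicator_of_notMem h1]
    exact zero_le

/-- The Lebesgue weight `y²` degenerates at the real axis but is at least 1 for `y > 1`. This is why
the analytic argument asks for integrability only over `Im z > 1`. -/
theorem setLIntegral_halfPlane_le_sq {g : ℂ → ℝ≥0∞} (hg : Measurable g) :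
    ∫⁻ z in {z : ℂ | 1 < z.im}, g z ≤ ∫⁻ y in Set.Ioi (0 : ℝ), ENNReal.ofReal (y ^ 2) *
      ∫⁻ x : ℝ, g ⟨x, y⟩ := by
  have hS : MeasurableSet {z : ℂ | 1 < z.im} :=
    (isOpen_lt continuous_const Complex.continuous_im).measurableSet
  have hpm : Measurable fun p : ℝ × ℝ => (⟨p.1, p.2⟩ : ℂ) :=
    Complex.measurableEquivRealProd.symm.measurable
  rw [← lintegral_indicator hS, ← Complex.volume_preserving_equiv_real_prod.symm.map_eq,
    lintegral_map (hg.indicator hS) Complex.measurableEquivRealProd.symm.measurable,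
    Measure.volume_eq_prod]
  have h2 : Measurable fun p : ℝ × ℝ => ({z : ℂ | 1 < z.im}).indicator g ⟨p.1, p.2⟩ :=
    (hg.indicator hS).comp hpm
  refine (lintegral_prod_symm _ h2.aemeasurable).trans_le ?_
  rw [← lintegral_indicator measurableSet_Ioi]
  refine lintegral_mono fun y => ?_
  by_cases hy : 1 < y
  · rw [Set.indicator_of_mem (show y ∈ Set.Ioi 0 from lt_trans one_pos hy)]
    refine le_trans ?_ (le_mul_of_one_le_left (zero_le)
      (ENNReal.one_le_ofReal.2 (by nlinarith : 1 ≤ y ^ 2)))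
    exact lintegral_mono fun x => Set.indicator_le_self _ _ _
  · have : ∀ x : ℝ, ({z : ℂ | 1 < z.im}).indicator g ⟨x, y⟩ = 0 := fun x =>
      Set.indicator_of_notMem (s := {z : ℂ | 1 < z.im}) hy _
    simp [this]

theorem setLIntegral_halfPlane_gaussDensity {f : ℍ → ℍ} {I : ℍ} (hI : I ∈ imUnits) :
    ∫⁻ z in {z : ℂ | 1 < z.im}, ‖f (sl I z)‖ₑ ^ 2 * ENNReal.ofReal (Real.exp (-‖z‖ ^ 2))
      = ∫⁻ z in {z : ℂ | 1 < z.im}, gaussDensity f (sl I z) := by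
  refine setLIntegral_congr_fun
    (isOpen_lt continuous_const Complex.continuous_im).measurableSet fun z hz => ?_
  exact (gaussDensity_sl hI (lt_trans one_pos (show 1 < z.im from hz)).ne').symm

theorem ae_lintegral_slice_lt_top_of_polar {f : ℍ → ℍ} (hf : ContinuousOn f offReal)
    (h : f ∈ gaussL2 polarMeasure) :
    ∀ᵐ w ∂(volume : Measure (EuclideanSpace ℝ (Fin 3))).toSphere,
      ∫⁻ z in {z : ℂ | 1 < z.im},
        ‖f (sl (sphereUnit w) z)‖ₑ ^ 2 * ENNReal.ofReal (Real.exp (-‖z‖ ^ 2)) < ⊤ := by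
  have hm := measurable_gaussDensity hf
  rw [mem_gaussL2_iff hf, lintegral_polarMeasure hm] at h
  have hmeas : Measurable fun I : ℍ => ∫⁻ r in Set.Ioi (0 : ℝ), ENNReal.ofReal r *
      ∫⁻ θ in Set.Ioo (0 : ℝ) (2 * Real.pi),
        gaussDensity f (slicePt I (r * Real.cos θ) (r * Real.sin θ)) := by
    refine Measurable.lintegral_prod_right' (f := fun q : ℍ × ℝ => ENNReal.ofReal q.2 *
      ∫⁻ θ in Set.Ioo (0 : ℝ) (2 * Real.pi),
        gaussDensity f (slicePt q.1 (q.2 * Real.cos θ) (q.2 * Real.sin θ))) ?_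
    refine (ENNReal.measurable_ofReal.comp measurable_snd).mul ?_
    refine Measurable.lintegral_prod_right' (f := fun q : (ℍ × ℝ) × ℝ =>
        gaussDensity f (slicePt q.1.1 (q.1.2 * Real.cos q.2) (q.1.2 * Real.sin q.2))) ?_
    exact hm.comp (continuous_slicePt.measurable.comp (f := fun q : (ℍ × ℝ) × ℝ =>
      (q.1.2 * Real.cos q.2, q.1.2 * Real.sin q.2, q.1.1)) (by fun_prop))
  have hae := ae_lt_top hmeas h.ne
  rw [sphereArea_eq] at hae
  filter_upwards [ae_of_ae_map continuous_sphereUnit.aemeasurable hae] with w hw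
  rw [setLIntegral_halfPlane_gaussDensity (sphereUnit_mem w)]
  exact (setLIntegral_halfPlane_le_polar (hm.comp (continuous_sl _).measurable)).trans_lt hw

theorem ae_lintegral_slice_lt_top_of_lebesgue {f : ℍ → ℍ} (hf : ContinuousOn f offReal)
    (h : f ∈ gaussL2 lebesgue) :
    ∀ᵐ w ∂(volume : Measure (EuclideanSpace ℝ (Fin 3))).toSphere,
      ∫⁻ z in {z : ℂ | 1 < z.im},
        ‖f (sl (sphereUnit w) z)‖ₑ ^ 2 * ENNReal.ofReal (Real.exp (-‖z‖ ^ 2)) < ⊤ := by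
  have hm := measurable_gaussDensity hf
  rw [mem_gaussL2_iff hf, lintegral_lebesgue hm] at h
  have hmeas : Measurable fun w => ∫⁻ y in Set.Ioi (0 : ℝ), ENNReal.ofReal (y ^ 2) *
      ∫⁻ x : ℝ, gaussDensity f (slicePt (sphereUnit w) x y) := by
    refine Measurable.lintegral_prod_right' (f := fun q : _ × ℝ => ENNReal.ofReal (q.2 ^ 2) *
      ∫⁻ x : ℝ, gaussDensity f (slicePt (sphereUnit q.1) x q.2)) ?_
    refine (ENNReal.measurable_ofReal.comp (measurable_snd.pow_const 2)).mul ?_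
    refine Measurable.lintegral_prod_right' (f := fun q : (_ × ℝ) × ℝ =>
        gaussDensity f (slicePt (sphereUnit q.1.1) q.2 q.1.2)) ?_
    have := continuous_sphereUnit.measurable
    exact hm.comp (continuous_slicePt.measurable.comp
      (f := fun q : (Metric.sphere (0 : EuclideanSpace ℝ (Fin 3)) 1 × ℝ) × ℝ =>
        (q.2, q.1.2, sphereUnit q.1.1)) (by fun_prop))
  filter_upwards [ae_lt_top hmeas h.ne] with w hw
  rw [setLIntegral_halfPlane_gaussDensity (sphereUnit_mem w)]
  exact (setLIntegral_halfPlane_le_sq (hm.comp (continuous_sl _).measurable)).trans_lt hw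

/-! ### From almost every slice to all slices, and the equality of the two spaces. -/

/-- Holomorphy of the components on the upper half of a slice passes to limits of slices. -/
theorem differentiableOn_coord_of_mem_closure {f : ℍ → ℍ} (hf : ContinuousOn f offReal)
    {T : Set ℍ} (hT : T ⊆ imUnits) (k : Fin 4)
    (h : ∀ J ∈ T, DifferentiableOn ℂ (fun w => coord J (stdBasis k) (f (sl J w))) {z | 0 < z.im})
    {I : ℍ} (hI : I ∈ imUnits) (hcl : I ∈ closure T) :
    DifferentiableOn ℂ (fun w => coord I (stdBasis k) (f (sl I w))) {z | 0 < z.im} := by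
  have hU : IsOpen {z : ℂ | 0 < z.im} := isOpen_lt continuous_const Complex.continuous_im
  have : (𝓝[T] I).NeBot := mem_closure_iff_nhdsWithin_neBot.1 hcl
  refine TendstoLocallyUniformlyOn.differentiableOn (φ := 𝓝[T] I)
    (F := fun J w => coord J (stdBasis k) (f (sl J w))) ?_ ?_ hU
  · rw [tendstoLocallyUniformlyOn_iff_forall_isCompact hU]
    intro K hK hKc
    have hcont : ContinuousOn (Function.uncurry fun (J : ℍ) (w : ℂ) =>
        coord J (stdBasis k) (f (sl J w))) (imUnits ×ˢ K) := by
      have h1 : ContinuousOn (fun p : ℍ × ℂ => f (sl p.1 p.2)) (imUnits ×ˢ K) := by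
        refine hf.comp continuous_sl_uncurry.continuousOn ?_
        rintro ⟨J, w⟩ ⟨hJ, hw⟩
        exact (slicePt_mem_offReal hJ).2 (ne_of_gt (hK hw))
      have h2 : (Function.uncurry fun (J : ℍ) (w : ℂ) => coord J (stdBasis k) (f (sl J w)))
          = fun p : ℍ × ℂ => ((inner ℝ (stdBasis k) (f (sl p.1 p.2)) : ℝ) : ℂ)
            - Complex.I * ((inner ℝ (stdBasis k) (p.1 * f (sl p.1 p.2)) : ℝ) : ℂ) := by
        ext1 p
        exact coord_apply _ _ _
      rw [h2]
      refine ContinuousOn.sub ?_ (ContinuousOn.mul continuousOn_const ?_)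
      · exact Complex.continuous_ofReal.comp_continuousOn (continuousOn_const.inner h1)
      · exact Complex.continuous_ofReal.comp_continuousOn
          (continuousOn_const.inner (continuous_fst.continuousOn.mul h1))
    intro u hu
    -- Joint continuity in `(J, w)` and compactness of `K` give convergence as `J → I`, uniformly on
    -- `K`.
    obtain ⟨v, hv, hvu⟩ := hKc.mem_uniformity_of_prod hcont hI (symm_le_uniformity hu)
    filter_upwards [nhdsWithin_mono I hT hv] with J hJ w hw
    exact hvu J hJ w hw
  · filter_upwards [self_mem_nhdsWithin] with J hJ using h J hJ

/-- The lower half of `ℂ_I` is the upper half of `ℂ_{-I}`, since `sl I w = sl (-I) w̄`. Conjugation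
and the change of sign of the unit compensate in the Cauchy–Riemann equations. -/
theorem differentiableOn_coord_of_upper {f : ℍ → ℍ}
    (h : ∀ I ∈ imUnits, ∀ k, DifferentiableOn ℂ (fun w => coord I (stdBasis k) (f (sl I w)))
      {z | 0 < z.im}) (hd : ∀ I ∈ imUnits, DifferentiableOn ℝ (fun w => f (sl I w)) {z | z.im ≠ 0})
    {I : ℍ} (hI : I ∈ imUnits) (k : Fin 4) :
    DifferentiableOn ℂ (fun w => coord I (stdBasis k) (f (sl I w))) {z | z.im ≠ 0} := by
  have hU : IsOpen {z : ℂ | 0 < z.im} := isOpen_lt continuous_const Complex.continuous_im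
  have hda : ∀ J ∈ imUnits, ∀ z : ℂ, z.im ≠ 0 → DifferentiableAt ℝ (fun w => f (sl J w)) z :=
    fun J hJ z hz => (hd J hJ).differentiableAt (isOpen_im_ne_zero.mem_nhds hz)
  have hcr : ∀ J ∈ imUnits, ∀ z : ℂ, 0 < z.im → fderiv ℝ (fun w => f (sl J w)) z Complex.I
      = J * fderiv ℝ (fun w => f (sl J w)) z 1 := fun J hJ z hz =>
    (differentiableAt_coord_iff hJ (hda J hJ z hz.ne')).1 fun k =>
      (h J hJ k).differentiableAt (hU.mem_nhds hz)
  intro z hz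
  apply DifferentiableAt.differentiableWithinAt
  refine (differentiableAt_coord_iff hI (hda I hI z hz)).2 ?_ k
  rcases lt_or_gt_of_ne hz with hlt | hgt
  · have hnI := neg_mem_imUnits hI
    have hz' : 0 < ((starRingEnd ℂ) z).im := by simpa using hlt
    have e1 : (fun w => f (sl I w)) = fun w => f (sl (-I) ((starRingEnd ℂ) w)) := by
      ext1 w
      simp only [sl, Complex.conj_re, Complex.conj_im, slicePt_neg_neg]
    have e2 : HasFDerivAt (fun w => f (sl (-I) ((starRingEnd ℂ) w)))
        ((fderiv ℝ (fun w => f (sl (-I) w)) ((starRingEnd ℂ) z)).comp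
          (Complex.conjCLE : ℂ →L[ℝ] ℂ)) z :=
      HasFDerivAt.comp (f := fun w : ℂ => (starRingEnd ℂ) w) z
        (hda (-I) hnI _ hz'.ne').hasFDerivAt Complex.conjCLE.hasFDerivAt
    rw [e1, e2.fderiv]
    simp only [ContinuousLinearMap.comp_apply, ContinuousLinearEquiv.coe_coe,
      Complex.conjCLE_apply, Complex.conj_I, map_neg, map_one]
    rw [hcr (-I) hnI _ hz', neg_mul, neg_neg]
  · exact hcr I hI z hgt

theorem sliceRegular_offReal_iff {f : ℍ → ℍ} : f ∈ sliceRegular offReal ↔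
    DifferentiableOn ℝ f offReal ∧ ∀ I ∈ imUnits, ∀ k,
      DifferentiableOn ℂ (fun w => coord I (stdBasis k) (f (sl I w))) {z | z.im ≠ 0} := by
  have key : ∀ I ∈ imUnits, ContDiffOn ℝ 1 (fun z => f (sl I z)) {z : ℂ | z.im ≠ 0} →
      ∀ z : ℂ, z.im ≠ 0 →
      ((1 / 2 : ℝ) • (partialX f I z.re z.im + I * partialY f I z.re z.im) = 0 ↔
        ∀ k, DifferentiableAt ℂ (fun w => coord I (stdBasis k) (f (sl I w))) z) := by
    intro I hI hcd z hz
    have hd : DifferentiableAt ℝ (fun z => f (sl I z)) z :=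
      (hcd.contDiffAt (isOpen_im_ne_zero.mem_nhds hz)).differentiableAt (by simp)
    rw [regular_iff_cauchyRiemann hI, differentiableAt_coord_iff hI hd, partialX_eq hd,
      partialY_eq hd]
  constructor
  · rintro ⟨hd, hcd, hcr⟩
    rw [sliceContDiff_iff] at hcd
    refine ⟨hd, fun I hI k z hz => DifferentiableAt.differentiableWithinAt ?_⟩
    exact (key I hI (hcd I hI) z hz).1 (hcr I hI _ _ ((slicePt_mem_offReal hI).2 hz)) k
  · rintro ⟨hd, hol⟩
    have hcd : ∀ I ∈ imUnits, ContDiffOn ℝ 1 (fun z => f (sl I z)) {z : ℂ | z.im ≠ 0} :=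
      fun I hI => contDiffOn_of_coord (n := 1) isOpen_im_ne_zero (hol I hI)
    refine ⟨hd, sliceContDiff_iff.2 hcd, fun I hI x y hxy => ?_⟩
    have hy : y ≠ 0 := (slicePt_mem_offReal hI).1 hxy
    exact (key I hI (hcd I hI) ⟨x, y⟩ hy).2 fun k =>
      (hol I hI k).differentiableAt (isOpen_im_ne_zero.mem_nhds hy)

theorem sliceRegular_of_box_eq_zero {f : ℍ → ℍ} (hd : DifferentiableOn ℝ f offReal)
    (hcd : SliceContDiff 2 f offReal) (hbox : ∀ q ∈ offReal, box f q = 0)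
    (hae : ∀ᵐ w ∂(volume : Measure (EuclideanSpace ℝ (Fin 3))).toSphere,
      ∫⁻ z in {z : ℂ | 1 < z.im},
        ‖f (sl (sphereUnit w) z)‖ₑ ^ 2 * ENNReal.ofReal (Real.exp (-‖z‖ ^ 2)) < ⊤) :
    f ∈ sliceRegular offReal := by
  rw [sliceContDiff_iff] at hcd
  -- The operator `box` reads `q` with `y = |Im q| > 0`, so it controls just the upper half of each
  -- slice.
  have hboxAt : ∀ I ∈ imUnits, ∀ x y : ℝ, 0 < y → boxAt f I x y = 0 := by
    intro I hI x y hy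
    have := hbox _ ((slicePt_mem_offReal hI (x := x)).2 hy.ne')
    rwa [box, unitOf_slicePt hI hy, slicePt_re hI, norm_slicePt_im hI, abs_of_pos hy] at this
  refine sliceRegular_offReal_iff.2 ⟨hd, fun I hI k => differentiableOn_coord_of_upper ?_
    (fun J hJ => (hcd J hJ).differentiableOn (by simp)) hI k⟩
  intro J hJ j
  refine differentiableOn_coord_of_mem_closure hd.continuousOn (fun L hL => hL.1) j
    (fun L hL => ?_) hJ (mem_closure_of_ae (P := fun L => ∫⁻ z in {z : ℂ | 1 < z.im},
      ‖f (sl L z)‖ₑ ^ 2 * ENNReal.ofReal (Real.exp (-‖z‖ ^ 2)) < ⊤) hae hJ)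
  exact cauchyRiemann_of_boxAt_eq_zero hL.1 (hcd L hL.1) (hboxAt L hL.1) hL.2 j

theorem box_eq_zero_of_sliceRegular {f : ℍ → ℍ} (hf : f ∈ sliceRegular offReal) :
    SliceContDiff 2 f offReal ∧ ∀ q ∈ offReal, box f q = 0 := by
  have hol := (sliceRegular_offReal_iff.1 hf).2
  refine ⟨sliceContDiff_iff.2 fun I hI =>
    contDiffOn_of_coord (n := 2) isOpen_im_ne_zero (hol I hI), fun q hq => ?_⟩
  have h0 : ‖q.im‖ ≠ 0 := norm_ne_zero_iff.2 hq
  exact boxAt_eq_zero_of_holomorphic (unitOf_mem hq) (hol _ (unitOf_mem hq))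
    (z := ⟨q.re, ‖q.im‖⟩) h0

/-- The measure enters through one property: membership in its Gaussian `L²` space forces a finite
norm over `Im z > 1` on almost every slice. -/
theorem eigenspaceL2_zero_eq_fullFock {ν : Measure ℍ}
    (hν : ∀ f : ℍ → ℍ, ContinuousOn f offReal → f ∈ gaussL2 ν →
      ∀ᵐ w ∂(volume : Measure (EuclideanSpace ℝ (Fin 3))).toSphere,
        ∫⁻ z in {z : ℂ | 1 < z.im},
          ‖f (sl (sphereUnit w) z)‖ₑ ^ 2 * ENNReal.ofReal (Real.exp (-‖z‖ ^ 2)) < ⊤) :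
    eigenspaceL2 ν 0 = fullFock ν := by
  ext f
  constructor
  · rintro ⟨hL, hd, hcd, hbox⟩
    exact ⟨sliceRegular_of_box_eq_zero hd hcd (fun q hq => by rw [hbox q hq, mul_zero])
      (hν f hd.continuousOn hL), hL⟩
  · rintro ⟨hr, hL⟩
    have h := box_eq_zero_of_sliceRegular hr
    exact ⟨hL, hr.1, h.1, fun q hq => by rw [h.2 q hq, mul_zero]⟩

theorem eigenspaceL2_lebesgue_zero : eigenspaceL2 lebesgue 0 = fullFock lebesgue :=
  eigenspaceL2_zero_eq_fullFock fun _ => ae_lintegral_slice_lt_top_of_lebesgue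

theorem eigenspaceL2_polarMeasure_zero : eigenspaceL2 polarMeasure 0 = fullFock polarMeasure :=
  eigenspaceL2_zero_eq_fullFock fun _ => ae_lintegral_slice_lt_top_of_polar

/-! ### Extension across the real axis and Taylor coefficients. -/

open Complex in
theorem dense_im_ne_zero : Dense {z : ℂ | z.im ≠ 0} :=
  (dense_compl_singleton (0 : ℝ)).preimage isOpenMap_im

open Complex in
/-- A continuous function holomorphic off the real axis is entire. -/
theorem differentiable_of_differentiableOn_im_ne_zero {Φ : ℂ → ℂ} (hc : Continuous Φ)
    (hd : DifferentiableOn ℂ Φ {z | z.im ≠ 0}) : Differentiable ℂ Φ := by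
  -- Cauchy's theorem needs only continuity on the boundary, so a rectangle may have an edge on the
  -- real axis.
  have hhalf : ∀ x₁ x₂ a b : ℝ, (0 : ℝ) ∉ Set.Ioo (min a b) (max a b) →
      (∫ x : ℝ in x₁..x₂, Φ (x + a * I)) - (∫ x : ℝ in x₁..x₂, Φ (x + b * I)) +
      I • (∫ y : ℝ in a..b, Φ (x₂ + y * I)) - I • (∫ y : ℝ in a..b, Φ (x₁ + y * I)) = 0 := by
    intro x₁ x₂ a b h0
    refine integral_boundary_rect_eq_zero_of_continuousOn_of_differentiableOn Φ ⟨x₁, a⟩ ⟨x₂, b⟩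
      hc.continuousOn (hd.mono ?_)
    intro z hz h
    have : z.im ∈ Set.Ioo (min a b) (max a b) := hz.2
    rw [h] at this
    exact h0 this
  have hcons : IsConservativeOn Φ Set.univ := by
    intro z w _
    rw [← add_eq_zero_iff_eq_neg, wedgeIntegral_add_wedgeIntegral_eq]
    -- A general rectangle is cut along the real axis; the two integrals over the cut cancel, and
    -- Morera's theorem applies.
    have h1 := hhalf z.re w.re z.im 0 (by
      rintro ⟨h1, h2⟩; rcases le_total z.im 0 with h | h <;> simp [h] at h1 h2)
    have h2 := hhalf z.re w.re 0 w.im (by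
      rintro ⟨h1, h2⟩; rcases le_total w.im 0 with h | h <;> simp [h] at h1 h2)
    have hi : ∀ r a b : ℝ, IntervalIntegrable (fun y : ℝ => Φ (r + y * I)) volume a b :=
      fun r a b => Continuous.intervalIntegrable (hc.comp (continuous_const.add
        (continuous_ofReal.mul continuous_const))) a b
    rw [← intervalIntegral.integral_add_adjacent_intervals (hi w.re z.im 0) (hi w.re 0 w.im),
      ← intervalIntegral.integral_add_adjacent_intervals (hi z.re z.im 0) (hi z.re 0 w.im)]
    simp only [smul_eq_mul] at h1 h2 ⊢
    linear_combination h1 + h2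
  exact differentiableOn_univ.1 ((isConservativeOn_and_continuousOn_iff_isDifferentiableOn
    isOpen_univ).1 ⟨hcons, hc.continuousOn⟩)

theorem exists_entire_extension {φ : ℂ → ℂ} (hd : DifferentiableOn ℂ φ {z | z.im ≠ 0})
    (hlim : ∀ x : ℝ, ∃ l, Tendsto φ (𝓝[{z | z.im ≠ 0}] (x : ℂ)) (𝓝 l)) :
    ∃ Φ : ℂ → ℂ, Differentiable ℂ Φ ∧ ∀ z : ℂ, z.im ≠ 0 → Φ z = φ z := by
  have heq := extendFrom_extends hd.continuousOn
  refine ⟨extendFrom {z | z.im ≠ 0} φ, ?_, heq⟩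
  refine differentiable_of_differentiableOn_im_ne_zero
    (continuous_extendFrom dense_im_ne_zero fun z => ?_) (hd.congr heq)
  by_cases hz : z.im = 0
  · obtain ⟨l, hl⟩ := hlim z.re
    exact ⟨l, by rwa [show ((z.re : ℝ) : ℂ) = z from Complex.ext rfl (by simp [hz])] at hl⟩
  · exact ⟨φ z, hd.continuousOn z hz⟩

-- The coefficients are written as integrals over the unit circle because this form shows their
-- measurable dependence on the slice.
open Complex in
theorem hasSum_circle_coeff {Φ : ℂ → ℂ} (hΦ : Differentiable ℂ Φ) (z : ℂ) :
    HasSum (fun n : ℕ => z ^ n * ((2 * Real.pi : ℝ)⁻¹ •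
      ∫ θ in (0 : ℝ)..(2 * Real.pi), exp (-(n * θ * I)) * Φ (exp (θ * I)))) (Φ z) := by
  have h := (hΦ.hasFPowerSeriesOnBall 0 one_pos).hasSum (y := z) (by simp)
  rw [zero_add] at h
  have e : ∀ n : ℕ, z ^ n * ((2 * Real.pi : ℝ)⁻¹ •
      ∫ θ in (0 : ℝ)..(2 * Real.pi), exp (-(n * θ * I)) * Φ (exp (θ * I)))
      = cauchyPowerSeries Φ 0 (1 : NNReal) n fun _ => z := by
    intro n
    rw [cauchyPowerSeries_apply, circleIntegral]
    have e1 : ∀ θ : ℝ, deriv (circleMap 0 (1 : NNReal)) θ •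
        (z / (circleMap 0 (1 : NNReal) θ - 0)) ^ n •
          (circleMap 0 (1 : NNReal) θ - 0)⁻¹ • Φ (circleMap 0 (1 : NNReal) θ)
        = (I * z ^ n) * (exp (-(n * θ * I)) * Φ (exp (θ * I))) := by
      intro θ
      have e2 : circleMap 0 (1 : NNReal) θ = exp (θ * I) := by simp [circleMap]
      rw [deriv_circleMap, e2, sub_zero, div_pow, ← exp_nat_mul,
        show -((n : ℂ) * θ * I) = -(n * (θ * I)) by ring, exp_neg]
      simp only [smul_eq_mul]
      field_simp
    simp only [e1]
    rw [intervalIntegral.integral_const_mul, real_smul, smul_eq_mul]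
    generalize (∫ θ in (0 : ℝ)..(2 * Real.pi), exp (-(n * θ * I)) * Φ (exp (θ * I))) = J
    push_cast
    field_simp
  simpa only [e] using h

/-! ### Power series on circles, Parseval and Gaussian moments. -/

/-- The point `ri` has modulus `r` and lies off the real axis, so convergence there already gives
absolute convergence at radius `r`. -/
theorem summable_norm_mul_pow {c : ℕ → ℂ} {φ : ℂ → ℂ}
    (h : ∀ z : ℂ, z.im ≠ 0 → HasSum (fun n => z ^ n * c n) (φ z)) {r : ℝ} (hr : 0 < r) :
    Summable fun n => ‖c n‖ * r ^ n := by
  have := (h (r * Complex.I) (by simpa using hr.ne')).summable.norm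
  refine this.congr fun n => ?_
  simp [abs_of_pos hr, mul_comm]

theorem differentiable_tsum_pow {c : ℕ → ℂ} (h : ∀ r : ℝ, 0 < r → Summable fun n => ‖c n‖ * r ^ n) :
    Differentiable ℂ fun z => ∑' n, z ^ n * c n := by
  intro z
  have hd : DifferentiableOn ℂ (fun z => ∑' n, z ^ n * c n) (Metric.ball 0 (‖z‖ + 1)) := by
    refine Complex.differentiableOn_tsum_of_summable_norm (h (‖z‖ + 1) (by positivity))
      (fun n => by fun_prop) Metric.isOpen_ball fun n w hw => ?_
    rw [norm_mul, norm_pow, mul_comm]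
    rw [mem_ball_zero_iff] at hw
    gcongr
  exact hd.differentiableAt (Metric.isOpen_ball.mem_nhds (by simp))

open Complex in
theorem hasSum_integral_circle_mul {c : ℕ → ℂ} {r : ℝ} (hr : 0 ≤ r)
    (h : Summable fun n => ‖c n‖ * r ^ n) {g : ℝ → ℂ} (hg : Continuous g) :
    HasSum (fun n : ℕ => ∫ θ in (0 : ℝ)..(2 * Real.pi), (r * exp (θ * I)) ^ n * c n * g θ)
      (∫ θ in (0 : ℝ)..(2 * Real.pi), (∑' n, (r * exp (θ * I)) ^ n * c n) * g θ) := by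
  have hnorm : ∀ (n : ℕ) (θ : ℝ), ‖(r * exp (θ * I)) ^ n * c n‖ = ‖c n‖ * r ^ n := by
    intro n θ
    rw [norm_mul, norm_pow, norm_mul, norm_exp_ofReal_mul_I, norm_real, mul_one,
      Real.norm_of_nonneg hr, mul_comm]
  refine intervalIntegral.hasSum_integral_of_dominated_convergence
    (fun n θ => ‖c n‖ * r ^ n * ‖g θ‖) (fun n => ?_) (fun n => ?_) ?_ ?_ ?_
  · exact Continuous.aestronglyMeasurable (by fun_prop)
  · refine Eventually.of_forall fun θ _ => ?_
    rw [norm_mul, hnorm]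
  · exact Eventually.of_forall fun θ _ => h.mul_right _
  · simp only [tsum_mul_right]
    exact Continuous.intervalIntegrable (by fun_prop) _ _
  · refine Eventually.of_forall fun θ _ => ?_
    refine HasSum.mul_right _ (Summable.hasSum ?_)
    exact Summable.of_norm (h.congr fun n => (hnorm n θ).symm)

open Complex in
theorem integral_exp_mul_exp_neg (n m : ℕ) :
    ∫ θ in (0 : ℝ)..(2 * Real.pi), exp (θ * I) ^ n * exp (-(m * θ * I))
      = if n = m then 2 * Real.pi else 0 := by
  split_ifs with h
  · subst h
    have : ∀ θ : ℝ, exp (θ * I) ^ n * exp (-(n * θ * I)) = 1 := by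
      intro θ
      rw [← exp_nat_mul, ← exp_add, ← exp_zero]; congr 1; ring
    simp [this]
  · have hne : ((n : ℂ) - m) * I ≠ 0 := by
      refine mul_ne_zero (sub_ne_zero.2 (by exact_mod_cast h)) I_ne_zero
    have : ∀ θ : ℝ, exp (θ * I) ^ n * exp (-(m * θ * I)) = exp (((n - m) * I) * θ) := by
      intro θ
      rw [← exp_nat_mul, ← exp_add]; congr 1; ring
    simp only [this]
    rw [integral_exp_mul_complex hne]
    have e : exp (((n : ℂ) - m) * I * ((2 * Real.pi : ℝ) : ℂ)) = 1 := by
      rw [exp_eq_one_iff]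
      exact ⟨(n : ℤ) - m, by push_cast; ring⟩
    rw [e]
    simp

open Complex in
theorem integral_tsum_mul_exp_neg {c : ℕ → ℂ} {r : ℝ} (hr : 0 ≤ r)
    (h : Summable fun n => ‖c n‖ * r ^ n) (m : ℕ) :
    ∫ θ in (0 : ℝ)..(2 * Real.pi), (∑' n, (r * exp (θ * I)) ^ n * c n) * exp (-(m * θ * I))
      = 2 * Real.pi * (r ^ m * c m) := by
  have h1 := hasSum_integral_circle_mul hr h (g := fun θ => exp (-(m * θ * I))) (by fun_prop)
  have h2 : ∀ n : ℕ, ∫ θ in (0 : ℝ)..(2 * Real.pi),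
      (r * exp (θ * I)) ^ n * c n * exp (-(m * θ * I))
      = if n = m then 2 * Real.pi * (r ^ m * c m) else 0 := by
    intro n
    have e : ∀ θ : ℝ, (r * exp (θ * I)) ^ n * c n * exp (-(m * θ * I))
        = (r ^ n * c n) * (exp (θ * I) ^ n * exp (-(m * θ * I))) := by
      intro θ; rw [mul_pow]; ring
    simp only [e]
    rw [intervalIntegral.integral_const_mul, integral_exp_mul_exp_neg]
    split_ifs with hnm
    · subst hnm; push_cast; ring
    · simp
  simp only [h2] at h1
  exact h1.unique (hasSum_ite_eq m _)

open Complex ComplexConjugate in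
/-- Parseval's identity on the circle of radius `r`. -/
theorem hasSum_integral_norm_sq {c : ℕ → ℂ} {Φ : ℂ → ℂ} (hΦ : Continuous Φ)
    (hsum : ∀ z, HasSum (fun n => z ^ n * c n) (Φ z)) {r : ℝ} (hr : 0 ≤ r)
    (h : Summable fun n => ‖c n‖ * r ^ n) :
    HasSum (fun n : ℕ => 2 * Real.pi * (r ^ (2 * n) * ‖c n‖ ^ 2))
      (∫ θ in (0 : ℝ)..(2 * Real.pi), ‖Φ (r * exp (θ * I))‖ ^ 2) := by
  have htsum : ∀ z, ∑' n, z ^ n * c n = Φ z := fun z => (hsum z).tsum_eq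
  have hcont : Continuous fun θ : ℝ => Φ (r * exp (θ * I)) := by fun_prop
  have h1 := hasSum_integral_circle_mul hr h (g := fun θ => conj (Φ (r * exp (θ * I))))
    (continuous_conj.comp hcont)
  have hpi : (0 : ℝ) ≤ 2 * Real.pi := by positivity
  have h2 : ∀ n : ℕ, ∫ θ in (0 : ℝ)..(2 * Real.pi),
      (r * exp (θ * I)) ^ n * c n * conj (Φ (r * exp (θ * I)))
      = ((2 * Real.pi * (r ^ (2 * n) * ‖c n‖ ^ 2) : ℝ) : ℂ) := by
    intro n
    -- Pairing one term of the series with `conj Φ` is, up to conjugation, a Fourier coefficient of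
    -- `Φ` on the circle, which is known from orthogonality.
    have e : ∀ θ : ℝ, (r * exp (θ * I)) ^ n * c n * conj (Φ (r * exp (θ * I)))
        = (r ^ n * c n) * conj ((∑' n, (r * exp (θ * I)) ^ n * c n) * exp (-(n * θ * I))) := by
      intro θ
      rw [htsum, map_mul, ← exp_conj, mul_pow, ← exp_nat_mul]
      simp only [map_neg, map_mul, conj_I, conj_ofReal, map_natCast]
      rw [show -((n : ℂ) * θ * -I) = n * (θ * I) by ring]
      ring
    simp only [e]
    rw [intervalIntegral.integral_const_mul, intervalIntegral.integral_of_le hpi, integral_conj,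
      ← intervalIntegral.integral_of_le hpi, integral_tsum_mul_exp_neg hr h]
    simp only [map_mul, map_pow, conj_ofReal, map_ofNat]
    push_cast
    rw [← Complex.mul_conj']
    ring
  have h3 : ∫ θ in (0 : ℝ)..(2 * Real.pi), (∑' n, (r * exp (θ * I)) ^ n * c n) *
      conj (Φ (r * exp (θ * I)))
      = ((∫ θ in (0 : ℝ)..(2 * Real.pi), ‖Φ (r * exp (θ * I))‖ ^ 2 : ℝ) : ℂ) := by
    rw [← intervalIntegral.integral_ofReal]
    congr 1
    ext θ
    rw [htsum, Complex.mul_conj']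
    push_cast
    rfl
  simp only [h2] at h1
  rw [h3] at h1
  exact_mod_cast h1

/-- The substitution `t = r²` gives `½ Γ(n + 1)`. -/
theorem lintegral_pow_mul_exp_neg_sq (n : ℕ) :
    ∫⁻ r in Set.Ioi (0 : ℝ), ENNReal.ofReal (r * Real.exp (-r ^ 2) * r ^ (2 * n))
      = ENNReal.ofReal (n.factorial / 2) := by
  have h1 := integral_rpow_mul_exp_neg_rpow (p := 2) (q := 2 * n + 1) two_pos
    (by have : (0 : ℝ) ≤ n := Nat.cast_nonneg n; linarith)
  have h2 := integrableOn_rpow_mul_exp_neg_rpow (p := 2) (s := 2 * n + 1)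
    (by have : (0 : ℝ) ≤ n := Nat.cast_nonneg n; linarith) two_pos
  have e : Set.EqOn (fun x : ℝ => x ^ (2 * n + 1 : ℝ) * Real.exp (-x ^ (2 : ℝ)))
      (fun r => r * Real.exp (-r ^ 2) * r ^ (2 * n)) (Set.Ioi 0) := by
    intro x _
    have : x ^ (2 * n + 1 : ℝ) = x ^ (2 * n + 1) := by
      rw [← Real.rpow_natCast]; push_cast; rfl
    simp only [this, Real.rpow_two]
    ring
  rw [setIntegral_congr_fun measurableSet_Ioi e] at h1
  have h3 := h2.congr_fun e measurableSet_Ioi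
  rw [← ofReal_integral_eq_lintegral_ofReal h3, h1]
  · congr 1
    rw [show ((2 * n + 1 + 1 : ℝ)) / 2 = n + 1 by ring, Real.Gamma_nat_eq_factorial]
    ring
  · filter_upwards [ae_restrict_mem measurableSet_Ioi] with x hx
    have : (0 : ℝ) < x := hx
    positivity

/-! ### Slice Taylor coefficients and the norm identity. -/

theorem hasSum_of_coord {I : ℍ} {a : ℕ → ℍ} {b : ℍ}
    (h : ∀ k, HasSum (fun n => coord I (stdBasis k) (a n)) (coord I (stdBasis k) b)) :
    HasSum a b := by
  have h1 : HasSum (fun n => ∑ k, (coord I (stdBasis k) (a n)).re • stdBasis k)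
      (∑ k, (coord I (stdBasis k) b).re • stdBasis k) :=
    hasSum_sum fun k _ => (Complex.reCLM.hasSum (h k)).smul_const _
  simpa only [sum_coord_re_smul] using h1

theorem sl_circle (I : ℍ) (r θ : ℝ) :
    slicePt I (r * Real.cos θ) (r * Real.sin θ) = sl I (r * Complex.exp (θ * Complex.I)) := by
  simp [sl, Complex.exp_ofReal_mul_I_re, Complex.exp_ofReal_mul_I_im]

theorem im_circle (r θ : ℝ) : (r * Complex.exp (θ * Complex.I)).im = r * Real.sin θ := by
  simp [Complex.exp_ofReal_mul_I_im]

/-- Circles meet the real axis in a null set of angles, so the cutoff by `offReal` is invisible to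
circle integrals. -/
theorem ae_sin_ne_zero : ∀ᵐ θ : ℝ, Real.sin θ ≠ 0 := by
  have hc : {θ : ℝ | Real.sin θ = 0}.Countable := by
    refine (Set.countable_range fun n : ℤ => (n : ℝ) * Real.pi).mono fun θ hθ => ?_
    obtain ⟨n, hn⟩ := Real.sin_eq_zero_iff.1 hθ
    exact ⟨n, hn⟩
  exact measure_eq_zero_iff_ae_notMem.1 (hc.measure_zero volume)

/-- The Taylor coefficients of `f` on the slice `ℂ_I`, as integrals over the unit circle. -/
noncomputable def sliceCoeff (f : ℍ → ℍ) (n : ℕ) (I : ℍ) : ℍ :=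
  (2 * Real.pi)⁻¹ • ∫ θ in (0 : ℝ)..(2 * Real.pi),
    sl I (Complex.exp (-(n * θ * Complex.I))) *
      offReal.indicator f (sl I (Complex.exp (θ * Complex.I)))

/-- The integrand is jointly measurable in `(I, θ)`, and integrating out `θ` preserves
measurability. -/
theorem measurable_sliceCoeff {f : ℍ → ℍ} (hf : ContinuousOn f offReal) (n : ℕ) :
    Measurable (sliceCoeff f n) := by
  have hpi : (0 : ℝ) ≤ 2 * Real.pi := by positivity
  unfold sliceCoeff
  simp only [intervalIntegral.integral_of_le hpi]
  have h1 : Measurable fun p : ℍ × ℝ => sl p.1 (Complex.exp (-(n * p.2 * Complex.I))) :=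
    (show Measurable fun p : ℍ × ℂ => sl p.1 p.2 from continuous_sl_uncurry.measurable).comp
      (f := fun p : ℍ × ℝ => (p.1, Complex.exp (-(n * p.2 * Complex.I)))) (by fun_prop)
  have h2 : Measurable fun p : ℍ × ℝ => sl p.1 (Complex.exp (p.2 * Complex.I)) :=
    (show Measurable fun p : ℍ × ℂ => sl p.1 p.2 from continuous_sl_uncurry.measurable).comp
      (f := fun p : ℍ × ℝ => (p.1, Complex.exp (p.2 * Complex.I))) (by fun_prop)
  have h3 : Measurable fun p : ℍ × ℝ => sl p.1 (Complex.exp (-(n * p.2 * Complex.I))) *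
      offReal.indicator f (sl p.1 (Complex.exp (p.2 * Complex.I))) :=
    h1.mul ((measurable_indicator_offReal hf).comp h2)
  have h4 : StronglyMeasurable fun I : ℍ => ∫ θ in Set.Ioc (0 : ℝ) (2 * Real.pi),
      sl I (Complex.exp (-(n * θ * Complex.I))) *
        offReal.indicator f (sl I (Complex.exp (θ * Complex.I))) :=
    h3.stronglyMeasurable.integral_prod_right'
  exact (continuous_const_smul ((2 * Real.pi)⁻¹ : ℝ)).measurable.comp h4.measurable

theorem coord_sliceCoeff {f : ℍ → ℍ} {I : ℍ} (hI : I ∈ imUnits) {Φ : Fin 4 → ℂ → ℂ}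
    (hΦ : ∀ k, Continuous (Φ k))
    (hf : ∀ k, ∀ z : ℂ, z.im ≠ 0 → Φ k z = coord I (stdBasis k) (f (sl I z))) (n : ℕ) (k : Fin 4) :
    coord I (stdBasis k) (sliceCoeff f n I) = (2 * Real.pi : ℝ)⁻¹ •
      ∫ θ in (0 : ℝ)..(2 * Real.pi),
        Complex.exp (-(n * θ * Complex.I)) * Φ k (Complex.exp (θ * Complex.I)) := by
  have hmem : ∀ θ : ℝ, Real.sin θ ≠ 0 → (Complex.exp (θ * Complex.I)).im ≠ 0 := by
    intro θ hθ
    rwa [Complex.exp_ofReal_mul_I_im]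
  have hind : ∀ θ : ℝ, Real.sin θ ≠ 0 → offReal.indicator f (sl I (Complex.exp (θ * Complex.I)))
      = f (sl I (Complex.exp (θ * Complex.I))) := fun θ hθ =>
    Set.indicator_of_mem (show sl I (Complex.exp (θ * Complex.I)) ∈ offReal from
      (slicePt_mem_offReal hI).2 (hmem θ hθ)) _
  have hint : IntervalIntegrable (fun θ : ℝ => sl I (Complex.exp (-(n * θ * Complex.I))) *
      offReal.indicator f (sl I (Complex.exp (θ * Complex.I)))) volume 0 (2 * Real.pi) := by
    have hc : Continuous fun θ : ℝ => sl I (Complex.exp (-(n * θ * Complex.I))) *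
        ∑ k, (Φ k (Complex.exp (θ * Complex.I))).re • stdBasis k := by
      have h1 : Continuous fun θ : ℝ => sl I (Complex.exp (-(n * θ * Complex.I))) :=
        (continuous_sl I).comp (by fun_prop)
      refine h1.mul (continuous_finsetSum _ fun k _ => Continuous.fun_smul ?_ continuous_const)
      exact Complex.continuous_re.comp ((hΦ k).comp (by fun_prop))
    refine (hc.intervalIntegrable 0 (2 * Real.pi)).congr_ae ?_
    refine ae_restrict_of_ae ?_
    filter_upwards [ae_sin_ne_zero] with θ hθ
    rw [hind θ hθ]
    simp only [hf _ _ (hmem θ hθ), sum_coord_re_smul]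
  rw [sliceCoeff, map_smul, ← ContinuousLinearMap.intervalIntegral_comp_comm _ hint]
  congr 1
  refine intervalIntegral.integral_congr_ae ?_
  filter_upwards [ae_sin_ne_zero] with θ hθ _
  rw [hind θ hθ, coord_sl_mul hI, hf k _ (hmem θ hθ)]

theorem hasSum_sliceCoeff {f : ℍ → ℍ} {I : ℍ} (hI : I ∈ imUnits) {Φ : Fin 4 → ℂ → ℂ}
    (hΦ : ∀ k, Differentiable ℂ (Φ k))
    (hf : ∀ k, ∀ z : ℂ, z.im ≠ 0 → Φ k z = coord I (stdBasis k) (f (sl I z))) {z : ℂ}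
    (hz : z.im ≠ 0) : HasSum (fun n => sl I z ^ n * sliceCoeff f n I) (f (sl I z)) := by
  refine hasSum_of_coord (I := I) fun k => ?_
  rw [← hf k z hz]
  have e : ∀ n, coord I (stdBasis k) (sl I z ^ n * sliceCoeff f n I) = z ^ n *
      ((2 * Real.pi : ℝ)⁻¹ • ∫ θ in (0 : ℝ)..(2 * Real.pi),
        Complex.exp (-(n * θ * Complex.I)) * Φ k (Complex.exp (θ * Complex.I))) := by
    intro n
    rw [← sl_pow hI, coord_sl_mul hI, coord_sliceCoeff hI (fun k => (hΦ k).continuous) hf]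
  simp only [e]
  exact hasSum_circle_coeff (hΦ k) z

/-- The entire functions extending the components of a power series on a slice. -/
theorem exists_entire_of_hasSum {f : ℍ → ℍ} {I : ℍ} (hI : I ∈ imUnits) {c : ℕ → ℍ}
    (hs : ∀ z : ℂ, z.im ≠ 0 → HasSum (fun n => sl I z ^ n * c n) (f (sl I z))) (k : Fin 4) :
    ∃ Φ : ℂ → ℂ, Differentiable ℂ Φ ∧
      (∀ z : ℂ, z.im ≠ 0 → Φ z = coord I (stdBasis k) (f (sl I z))) ∧
      (∀ z, HasSum (fun n => z ^ n * coord I (stdBasis k) (c n)) (Φ z)) ∧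
      ∀ r : ℝ, 0 < r → Summable fun n => ‖coord I (stdBasis k) (c n)‖ * r ^ n := by
  have h1 : ∀ z : ℂ, z.im ≠ 0 → HasSum (fun n => z ^ n * coord I (stdBasis k) (c n))
      (coord I (stdBasis k) (f (sl I z))) := by
    intro z hz
    have := (coord I (stdBasis k)).hasSum (hs z hz)
    simpa only [Function.comp_def, ← sl_pow hI, coord_sl_mul hI] using this
  have h2 := fun (r : ℝ) (hr : 0 < r) => summable_norm_mul_pow h1 hr
  refine ⟨_, differentiable_tsum_pow h2, fun z hz => (h1 z hz).tsum_eq, fun z => ?_, h2⟩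
  refine Summable.hasSum (Summable.of_norm_bounded (h2 (‖z‖ + 1) (by positivity)) fun n => ?_)
  rw [norm_mul, norm_pow, mul_comm]
  gcongr
  linarith

/-- The Gaussian norm of a power series on one slice. -/
theorem lintegral_slice_eq_tsum {f : ℍ → ℍ} {I : ℍ} (hI : I ∈ imUnits) {c : ℕ → ℍ}
    (hs : ∀ z : ℂ, z.im ≠ 0 → HasSum (fun n => sl I z ^ n * c n) (f (sl I z))) :
    ∫⁻ r in Set.Ioi (0 : ℝ), ENNReal.ofReal r * ∫⁻ θ in Set.Ioo (0 : ℝ) (2 * Real.pi),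
        gaussDensity f (slicePt I (r * Real.cos θ) (r * Real.sin θ))
      = ENNReal.ofReal Real.pi * ∑' n : ℕ, (n.factorial : ℝ≥0∞) * ‖c n‖ₑ ^ 2 := by
  have hpi : (0 : ℝ) ≤ 2 * Real.pi := by positivity
  choose Φ hΦd hΦf hΦs hΦn using exists_entire_of_hasSum hI hs
  have hinner : ∀ r : ℝ, 0 < r → ENNReal.ofReal r * ∫⁻ θ in Set.Ioo (0 : ℝ) (2 * Real.pi),
      gaussDensity f (slicePt I (r * Real.cos θ) (r * Real.sin θ))
      = ∑' n : ℕ, (ENNReal.ofReal (2 * Real.pi) * ‖c n‖ₑ ^ 2) *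
        ENNReal.ofReal (r * Real.exp (-r ^ 2) * r ^ (2 * n)) := by
    intro r hr
    -- Parseval is summed over the four components; the factor 1/2 undoes the double counting in
    -- `sum_norm_coord_sq`.
    have hsum : HasSum (fun n : ℕ => 2 * Real.pi * (r ^ (2 * n) * ‖c n‖ ^ 2))
        (∫ θ in (0 : ℝ)..(2 * Real.pi),
          (1 / 2) * ∑ k, ‖Φ k (r * Complex.exp (θ * Complex.I))‖ ^ 2) := by
      have h1 := hasSum_sum (s := Finset.univ) fun k _ =>
        hasSum_integral_norm_sq (hΦd k).continuous (hΦs k) hr.le (hΦn k r hr)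
      rw [← intervalIntegral.integral_finsetSum] at h1
      · have h2 := h1.mul_left (1 / 2)
        rw [← intervalIntegral.integral_const_mul] at h2
        have e : ∀ n : ℕ, 2 * Real.pi * (r ^ (2 * n) * ‖c n‖ ^ 2) = 1 / 2 *
            ∑ k, 2 * Real.pi * (r ^ (2 * n) * ‖coord I (stdBasis k) (c n)‖ ^ 2) := by
          intro n
          rw [← Finset.mul_sum, ← Finset.mul_sum, sum_norm_coord_sq hI]
          ring
        simpa only [e] using h2
      · intro k _
        have := (hΦd k).continuous
        exact Continuous.intervalIntegrable (by fun_prop) _ _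
    have hae : ∀ᵐ θ ∂(volume.restrict (Set.Ioo (0 : ℝ) (2 * Real.pi))),
        gaussDensity f (slicePt I (r * Real.cos θ) (r * Real.sin θ))
        = ENNReal.ofReal ((1 / 2) * ∑ k, ‖Φ k (r * Complex.exp (θ * Complex.I))‖ ^ 2) *
          ENNReal.ofReal (Real.exp (-r ^ 2)) := by
      refine ae_restrict_of_ae ?_
      filter_upwards [ae_sin_ne_zero] with θ hθ
      have him : (r * Complex.exp (θ * Complex.I)).im ≠ 0 := by
        rw [im_circle]; exact mul_ne_zero hr.ne' hθ
      rw [sl_circle, gaussDensity_sl hI him]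
      simp only [hΦf _ _ him, sum_norm_coord_sq hI]
      rw [show (1 / 2 : ℝ) * (2 * ‖f (sl I (r * Complex.exp (θ * Complex.I)))‖ ^ 2)
        = ‖f (sl I (r * Complex.exp (θ * Complex.I)))‖ ^ 2 by ring,
        ENNReal.ofReal_pow (norm_nonneg _), ofReal_norm, norm_mul, Complex.norm_exp_ofReal_mul_I,
        Complex.norm_real, mul_one, Real.norm_of_nonneg hr.le]
    have hcont : Continuous fun θ : ℝ =>
        (1 / 2) * ∑ k, ‖Φ k (r * Complex.exp (θ * Complex.I))‖ ^ 2 := by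
      have := fun k => (hΦd k).continuous
      fun_prop
    rw [lintegral_congr_ae hae, lintegral_mul_const' _ _ ENNReal.ofReal_ne_top,
      ← ofReal_integral_eq_lintegral_ofReal, ← integral_Ioc_eq_integral_Ioo,
      ← intervalIntegral.integral_of_le hpi, ← hsum.tsum_eq,
      ENNReal.ofReal_tsum_of_nonneg (fun n => by positivity) hsum.summable, mul_comm (tsum _),
      ← mul_assoc, ← ENNReal.tsum_mul_left]
    · refine tsum_congr fun n => ?_
      rw [← ofReal_norm, ← ENNReal.ofReal_pow (norm_nonneg _), ← ENNReal.ofReal_mul hr.le,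
        ← ENNReal.ofReal_mul (by positivity), ← ENNReal.ofReal_mul (by positivity),
        ← ENNReal.ofReal_mul (by positivity)]
      congr 1
      ring
    · exact (hcont.integrableOn_Icc (a := 0) (b := 2 * Real.pi)).mono_set Set.Ioo_subset_Icc_self
    · exact Eventually.of_forall fun θ => by positivity
  rw [setLIntegral_congr_fun measurableSet_Ioi fun r hr => hinner r hr, lintegral_tsum]
  · rw [← ENNReal.tsum_mul_left]
    refine tsum_congr fun n => ?_
    rw [lintegral_const_mul' _ _ (by finiteness), lintegral_pow_mul_exp_neg_sq,
      mul_right_comm, ← ENNReal.ofReal_mul hpi,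
      show 2 * Real.pi * ((n.factorial : ℝ) / 2) = Real.pi * n.factorial by ring,
      ENNReal.ofReal_mul Real.pi_pos.le, ENNReal.ofReal_natCast, mul_assoc]
  · intro n
    fun_prop

theorem lintegral_polarMeasure_eq_tsum {f : ℍ → ℍ} (hf : ContinuousOn f offReal) {C : ℕ → ℍ → ℍ}
    (hC : ∀ n, Measurable (C n))
    (hs : ∀ I ∈ imUnits, ∀ z : ℂ, z.im ≠ 0 →
      HasSum (fun n => sl I z ^ n * C n I) (f (sl I z))) :
    ∫⁻ q, gaussDensity f q ∂polarMeasure = ENNReal.ofReal Real.pi *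
      ∑' n : ℕ, (n.factorial : ℝ≥0∞) * ∫⁻ I, ‖C n I‖ₑ ^ 2 ∂sphereArea := by
  rw [lintegral_polarMeasure (measurable_gaussDensity hf)]
  have h1 := ae_mem_imUnits.mono fun I hI => lintegral_slice_eq_tsum hI (hs I hI)
  rw [lintegral_congr_ae h1, lintegral_const_mul' _ _ ENNReal.ofReal_ne_top, lintegral_tsum]
  · congr 1
    refine tsum_congr fun n => ?_
    rw [lintegral_const_mul' _ _ (by finiteness)]
  · intro n
    have := hC n
    fun_prop

theorem mem_gaussL2_polarMeasure_iff {f : ℍ → ℍ} (hf : ContinuousOn f offReal) {C : ℕ → ℍ → ℍ}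
    (hC : ∀ n, Measurable (C n))
    (hs : ∀ I ∈ imUnits, ∀ z : ℂ, z.im ≠ 0 →
      HasSum (fun n => sl I z ^ n * C n I) (f (sl I z))) :
    f ∈ gaussL2 polarMeasure ↔
      ∑' n : ℕ, (n.factorial : ℝ≥0∞) * ∫⁻ I, ‖C n I‖ₑ ^ 2 ∂sphereArea < ⊤ := by
  rw [mem_gaussL2_iff hf, lintegral_polarMeasure_eq_tsum hf hC hs]
  constructor
  · intro h
    exact ENNReal.lt_top_of_mul_ne_top_right h.ne (by simp [Real.pi_pos])
  · exact fun h => ENNReal.mul_lt_top ENNReal.ofReal_lt_top h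

/-! ### The Fock space with limits on the real axis as a space of power series. -/

theorem fullFock_inter_sliceExtendable :
    fullFock polarMeasure ∩ sliceExtendable = fockSeries := by
  ext f
  constructor
  · rintro ⟨⟨hreg, hL⟩, hext⟩
    obtain ⟨hd, hol⟩ := sliceRegular_offReal_iff.1 hreg
    have hs : ∀ I ∈ imUnits, ∀ z : ℂ, z.im ≠ 0 →
        HasSum (fun n => sl I z ^ n * sliceCoeff f n I) (f (sl I z)) := by
      intro I hI
      have hent : ∀ k, ∃ Φ : ℂ → ℂ, Differentiable ℂ Φ ∧
          ∀ z : ℂ, z.im ≠ 0 → Φ z = coord I (stdBasis k) (f (sl I z)) := by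
        intro k
        refine exists_entire_extension (hol I hI k) fun x => ?_
        obtain ⟨l, hl⟩ := hext I hI x
        refine ⟨coord I (stdBasis k) l,
          ((coord I (stdBasis k)).continuous.tendsto l).comp (Tendsto.comp (f := fun z : ℂ =>
            Complex.equivRealProdCLM z) (g := fun p : ℝ × ℝ => f (slicePt I p.1 p.2)) hl ?_)⟩
        refine tendsto_nhdsWithin_iff.2 ⟨?_, ?_⟩
        · have : Tendsto Complex.equivRealProdCLM (𝓝 (x : ℂ)) (𝓝 (x, 0)) :=
            Complex.equivRealProdCLM.continuous.tendsto' _ _ (by simp)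
          exact this.mono_left nhdsWithin_le_nhds
        · exact eventually_mem_nhdsWithin
      choose Φ hΦd hΦf using hent
      exact fun z hz => hasSum_sliceCoeff hI hΦd hΦf hz
    have hC := measurable_sliceCoeff hd.continuousOn
    exact ⟨hd, sliceCoeff f, hC, fun I hI x y hy => hs I hI ⟨x, y⟩ hy,
      (mem_gaussL2_polarMeasure_iff hd.continuousOn hC hs).1 hL⟩
  · rintro ⟨hd, C, hC, hs', hfin⟩
    have hs : ∀ I ∈ imUnits, ∀ z : ℂ, z.im ≠ 0 →
        HasSum (fun n => sl I z ^ n * C n I) (f (sl I z)) :=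
      fun I hI z hz => hs' I hI z.re z.im hz
    refine ⟨⟨sliceRegular_offReal_iff.2 ⟨hd, fun I hI k => ?_⟩,
      (mem_gaussL2_polarMeasure_iff hd.continuousOn hC hs).2 hfin⟩, fun I hI x => ?_⟩
    · obtain ⟨Φ, hΦd, hΦf, -⟩ := exists_entire_of_hasSum hI (hs I hI) k
      exact hΦd.differentiableOn.congr fun z hz => (hΦf z hz).symm
    · choose Φ hΦd hΦf _ using exists_entire_of_hasSum hI (hs I hI)
      -- The limit at a real point is the value of the entire extension, reassembled from its four
      -- components.
      refine ⟨∑ k, (Φ k x).re • stdBasis k, ?_⟩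
      have hc : Continuous fun p : ℝ × ℝ => ∑ k, (Φ k ⟨p.1, p.2⟩).re • stdBasis k := by
        refine continuous_finsetSum _ fun k _ => Continuous.fun_smul ?_ continuous_const
        exact Complex.continuous_re.comp
          ((hΦd k).continuous.comp Complex.equivRealProdCLM.symm.continuous)
      have ht : Tendsto (fun p : ℝ × ℝ => ∑ k, (Φ k ⟨p.1, p.2⟩).re • stdBasis k)
          (𝓝[{p | p.2 ≠ 0}] (x, 0)) (𝓝 (∑ k, (Φ k x).re • stdBasis k)) :=
        (hc.tendsto (x, 0)).mono_left nhdsWithin_le_nhds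
      refine ht.congr' ?_
      filter_upwards [self_mem_nhdsWithin] with p hp
      simp only [hΦf _ ⟨p.1, p.2⟩ hp, sum_coord_re_smul]
      rfl

end SliceFock

theorem mainTheorem11 :
    SliceFock.eigenspaceL2 SliceFock.lebesgue 0 = SliceFock.fullFock SliceFock.lebesgue ∧
    SliceFock.eigenspaceL2 SliceFock.polarMeasure 0 = SliceFock.fullFock SliceFock.polarMeasure ∧
    SliceFock.eigenspaceL2 SliceFock.polarMeasure 0 ∩ SliceFock.sliceExtendable
      = SliceFock.fockSeries ∧
    SliceFock.fullFock SliceFock.polarMeasure ∩ SliceFock.sliceExtendable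
      = SliceFock.fockSeries := by
  refine ⟨SliceFock.eigenspaceL2_lebesgue_zero, SliceFock.eigenspaceL2_polarMeasure_zero, ?_,
    SliceFock.fullFock_inter_sliceExtendable⟩
  rw [SliceFock.eigenspaceL2_polarMeasure_zero, SliceFock.fullFock_inter_sliceExtendable]
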